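/- **Conventions.** A *partial group* $\mathcal P$ consists of a set $\mathcal P_1$, sets $\mathcal P_n\subseteq \mathcal P_1^{\,n}$ of "multipliable" words ($n\ge 1$) with products $\triangledown_n:\mathcal P_n\to\mathcal P_1$ ($\triangledown_1=\mathrm{id}$), a unit and an inversion, such that: deleting the first or the last letter of a word in $\mathcal P_n$ ($n>1$) gives a word in $\mathcal P_{n-1}$; multiplying a nonempty block of a word inside it gives a multipliable word with the same product; inserting $1$ anywhere in a multipliable word gives a multipliable word; $\triangledown_2(1,x)=x=\triangledown_2(x,1)$; for $w=(x_1,\dots,x_n)\in\mathcal P_n$ and $w^{-1}=(x_n^{-1},\dots,x_1^{-1})$ the concatenations $w\times w^{-1}$ and $w^{-1}\times w$ are multipliable; and $\triangledown_2(x,x^{-1})=1=\triangledown_2(x^{-1},x)$. A map $\mathcal Q\to\mathcal P$ is a map $\mathcal Q_1\to\mathcal P_1$ that carries $\mathcal Q_n$ into $\mathcal P_n$ and respects all products; isomorphisms are the isomorphisms of the resulting category. A group $G$ is a partial group with $G_n=G^n$. All groups act from the right. For a right $G_0$-set $X_0$ and a nonempty $X\subseteq X_0$ let $\mathcal P(X,X_0,G_0)$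 be the partial group whose multipliable words are the $(g_1,\dots,g_n)\in G_0^n$ for which some $x\in X$ has $xg_1,\,xg_1g_2,\dots,xg_1\cdots g_n\in X$, with the product of $G_0$. For a figure $\emptyset\ne F\subseteq\mathbb R^d$ put $Sim\mathcal P(F)=\mathcal P(cc(F),2^{\mathbb R^d},Sim(d))$, where $cc(F)$ is the set of connected components of $F$ and $Sim(d)$ is the group of similarity transformations of $\mathbb R^d$. For $K\subseteq\mathbb R^d$ let $G(K)=\{a\in E(d): Ka=K\}$, where $E(d)$ is the isometry group of $\mathbb R^d$. Let $\mathcal V(\{0,1\})$ be the partial group whose multipliable words are $(\iota_1-\iota_0,\dots,\iota_n-\iota_{n-1})$ with $\iota_0,\dots,\iota_n\in\{0,1\}$, with product $\iota_n-\iota_0$. Let $\mathcal F,\mathcal H$ be partial groups. An *$\mathcal F$-set* is a set $X$ with sets $X\mathcal F_n\subseteq X\times\mathcal F_n$ and maps $\lhd: X\mathcal F_n\to X$ ($n\ge1$; also $X\mathcal F_0=X$, $\lhd_0=\mathrm{id}$) such that: dropping the last letter keeps $(x|w)$ in the domain; if $(x|w\times w')$ is in the domain then so is $(\lhd(x|w)\,|\,w')$,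 and $\lhd(\lhd(x|w)|w')=\lhd(x|w\times w')$; multiplying a nonempty block inside $w$ keeps $(x|w)$ in the domain and does not change $\lhd(x|w)$; inserting $1$ into $w$ keeps $(x|w)$ in the domain; $\lhd(x|1)=x$; and if $(x|w)$ is in the domain, so is $(x|w\times w^{-1})$. A map $f:X\to Y$ of $\mathcal F$-sets satisfies $(f(x)|w)\in Y\mathcal F_n$ and $\lhd(f(x)|w)=f(\lhd(x|w))$ for all $(x|w)\in X\mathcal F_n$. An *$\mathcal F$-partial group structure* on $\mathcal H$ consists of $\mathcal F$-set structures on all $\mathcal H_r$, $r\ge1$, for which deleting the first or the last letter, multiplying a nonempty block at a given place, inserting $1$ at a given place, and $\eta\mapsto\eta^{\pm1}\times\eta^{\mp1}$ are maps of $\mathcal F$-sets, and $(1|w)\in\mathcal H_1\mathcal F_n$, $\lhd(1|w)=1$ for all $w\in\mathcal F_n$. The *semidirect product* $\mathcal F\ltimes\mathcal H$ has as elements the pairs $\gamma\ltimes\eta$ with $(\eta|\gamma^{-1})\in\mathcal H_1\mathcal F_1$. A word $\alpha=(\gamma_1\ltimes\eta_1,\dots,\gamma_n\ltimes\eta_n)$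 is multipliable if $(\eta_j|\gamma_{j+1},\dots,\gamma_n)\in\mathcal H_1\mathcal F_{n-j}$ for $1\le j<n$ and, with $A(\alpha)=(\lhd(\eta_1|\gamma_2,\dots,\gamma_n),\dots,\lhd(\eta_{n-1}|\gamma_n),\eta_n)$, one has $(A(\alpha)|\gamma_n^{-1},\dots,\gamma_1^{-1})\in\mathcal H_n\mathcal F_n$; the product is then $\triangledown_n(\gamma_1,\dots,\gamma_n)\ltimes\triangledown_n(A(\alpha))$. **Theorem.** Let $F\subseteq\mathbb R^d$ have exactly two connected components $F_+$ and $F_-$. Suppose that they are similar but not congruent, and that $0<\operatorname{diam}(F_\pm)<\infty$. Put $F_0=F_-$, $F_1=F_+$, and let $\gamma\in Sim(d)$ be any similarity with $F_0\gamma=F_1$. Then the inclusions $G(F_+)\cap G(F_-)\hookrightarrow G(F_\pm)$ have a pushout $\mathcal H=G(F_+)\vee_{G(F_+)\cap G(F_-)}G(F_-)$ in the category of partial groups. With the canonical maps $j_0:G(F_0)\to\mathcal H$ and $j_1:G(F_1)\to\mathcal H$, the following is a $\mathcal V(\{0,1\})$-partial group structure on $\mathcal H$: $$\mathcal H_r\mathcal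 V(\{0,1\})_n=\{(j_{\iota_0}(a_1),\dots,j_{\iota_0}(a_r)\,|\,\iota_1-\iota_0,\dots,\iota_n-\iota_{n-1}) : \iota_0,\dots,\iota_n\in\{0,1\},\ a_1,\dots,a_r\in G(F_{\iota_0})\},$$ $$\lhd\big((j_{\iota_0}(a_k))_k\,|\,\iota_1-\iota_0,\dots,\iota_n-\iota_{n-1}\big)=\big(j_{\iota_n}(\gamma^{\iota_0-\iota_n}a_k\gamma^{\iota_n-\iota_0})\big)_k ,$$ where $\gamma^{\iota_0-\iota_n}a_k\gamma^{\iota_n-\iota_0}\in G(F_{\iota_n})$; and for this structure $$Sim\mathcal P(F)\;\cong\;\mathcal V(\{0,1\})\ltimes\big(G(F_+)\vee_{G(F_+)\cap G(F_-)}G(F_-)\big)$$ as partial groups. -/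

import Mathlib

open CategoryTheory
open scoped Pointwise RightActions

universe u v

/-! ## Partial groups -/

/-- A partial group: a set `carrier` (the set `P₁`), for each `n ≥ 1` a set `Pₙ` of words of length
`n` (all of them together form `dom`, a set of nonempty words), and products `Pₙ → P₁`
(together: `prod`), with a unit and an inversion. -/
structure PartialGroup : Type (u + 1) where
  carrier : Type u
  /-- The words that can be multiplied; the words of length `n` in `dom` form `Pₙ`. -/
  dom : Set (List carrier)
  prod : (w : List carrier) → w ∈ dom → carrier
  nil_notMem : [] ∉ dom
  singleton_mem : ∀ x, [x] ∈ dom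
  prod_singleton : ∀ x, prod [x] (singleton_mem x) = x
  tail_mem : ∀ x w, x :: w ∈ dom → w ≠ [] → w ∈ dom
  dropLast_mem : ∀ w x, w ++ [x] ∈ dom → w ≠ [] → w ∈ dom
  /-- Multiplying a nonempty block inside a word of the domain gives a word of the domain with the
  same product. -/
  assoc : ∀ u v w (hv : v ∈ dom) (h : u ++ v ++ w ∈ dom),
    ∃ h' : u ++ [prod v hv] ++ w ∈ dom, prod _ h' = prod _ h
  one : carrier
  insert_one_mem : ∀ u v, u ++ v ∈ dom → u ++ [one] ++ v ∈ dom
  one_prod : ∀ x (h : [one, x] ∈ dom), prod _ h = x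
  prod_one : ∀ x (h : [x, one] ∈ dom), prod _ h = x
  inv : carrier → carrier
  append_inv_mem : ∀ w ∈ dom, w ++ (w.map inv).reverse ∈ dom
  inv_append_mem : ∀ w ∈ dom, (w.map inv).reverse ++ w ∈ dom
  prod_inv : ∀ x (h : [x, inv x] ∈ dom), prod _ h = one
  inv_prod : ∀ x (h : [inv x, x] ∈ dom), prod _ h = one

namespace PartialGroup

/-- The inverse word `(xₙ⁻¹, …, x₁⁻¹)`. -/
def invWord (P : PartialGroup.{u}) (w : List P.carrier) : List P.carrier :=
  (w.map P.inv).reverse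

/-- The disjoint union of all `Pₙ`, `n ≥ 1`. -/
abbrev Word (P : PartialGroup.{u}) : Type u := {w : List P.carrier // w ∈ P.dom}

/-- The word of length one. -/
def single (P : PartialGroup.{u}) (x : P.carrier) : P.Word := ⟨[x], P.singleton_mem x⟩

/-- Maps of partial groups: they send words of the domain to words of the domain and respect the
products (hence also the unit and the inverses). -/
@[ext]
structure Hom (P Q : PartialGroup.{u}) where
  toFun : P.carrier → Q.carrier
  map_mem : ∀ w ∈ P.dom, w.map toFun ∈ Q.dom
  map_prod : ∀ w (h : w ∈ P.dom), Q.prod (w.map toFun) (map_mem w h) = toFun (P.prod w h)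

theorem prod_congr (P : PartialGroup.{u}) {w w' : List P.carrier} (e : w = w') (h : w ∈ P.dom)
    (h' : w' ∈ P.dom) : P.prod w h = P.prod w' h' := by
  subst e; rfl

/-- The category of partial groups. Its isomorphisms are the bijections `P₁ → Q₁` that are
maps of partial groups in both directions. -/
instance category : Category PartialGroup.{u} where
  Hom := Hom
  id P := ⟨id, fun w h => by simpa using h, fun w h => P.prod_congr (by simp) _ _⟩
  comp {P Q R} f g := ⟨g.toFun ∘ f.toFun,
    fun w h => by
      have := g.map_mem _ (f.map_mem w h)
      rwa [List.map_map] at this,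
    fun w h => by
      have h1 := g.map_prod _ (f.map_mem w h)
      rw [f.map_prod w h] at h1
      rw [Function.comp_apply, ← h1]
      exact R.prod_congr (by simp) _ _⟩

/-! ### Elementary consequences of the axioms -/

section Lemmas

variable (P : PartialGroup.{u})

theorem mem_of_append_left {u w : List P.carrier} (h : u ++ w ∈ P.dom) (hu : u ≠ []) :
    u ∈ P.dom := by
  induction w using List.reverseRecOn with
  | nil => simpa using h
  | append_singleton w x ih =>
    rw [← List.append_assoc] at h
    exact ih (P.dropLast_mem _ _ h (by simp [hu]))

theorem mem_of_append_right {u w : List P.carrier} (h : u ++ w ∈ P.dom) (hw : w ≠ []) :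
    w ∈ P.dom := by
  induction u with
  | nil => simpa using h
  | cons x u ih => exact ih (P.tail_mem _ _ h (by simp [hw]))

theorem ne_nil_of_mem {w : List P.carrier} (h : w ∈ P.dom) : w ≠ [] :=
  fun e => P.nil_notMem (e ▸ h)

theorem prod_eq_of_merge {u v w : List P.carrier} (hv : v ∈ P.dom) {y : P.carrier}
    (hy : P.prod v hv = y) {t s : List P.carrier} (ht : t ∈ P.dom) (et : t = u ++ v ++ w)
    (es : s = u ++ [y] ++ w) : ∃ h : s ∈ P.dom, P.prod s h = P.prod t ht := by
  subst et es hy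
  exact P.assoc u v w hv ht

theorem prod_insert_one {u v : List P.carrier} (h : u ++ v ∈ P.dom) :
    ∃ h' : u ++ [P.one] ++ v ∈ P.dom, P.prod _ h' = P.prod _ h := by
  have h' := P.insert_one_mem u v h
  refine ⟨h', ?_⟩
  rcases v with _ | ⟨y, v⟩
  · rcases List.eq_nil_or_concat u with rfl | ⟨u, y, rfl⟩
    · exact absurd h P.nil_notMem
    · have h2 : [y, P.one] ∈ P.dom :=
        P.mem_of_append_right (u := u) (by simpa using h') (by simp)
      obtain ⟨h3, e⟩ := P.prod_eq_of_merge (u := u) (w := []) h2 (P.prod_one y h2)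
        (s := u.concat y ++ []) h' (by simp) (by simp)
      exact e.symm
  · have h2 : [P.one, y] ∈ P.dom :=
      P.mem_of_append_left (w := v)
        (P.mem_of_append_right (u := u) (by simpa using h') (by simp)) (by simp)
    obtain ⟨h3, e⟩ := P.prod_eq_of_merge (u := u) (w := v) h2 (P.one_prod y h2)
      (s := u ++ y :: v) h' (by simp) (by simp)
    exact e.symm

theorem eq_inv_of_prod_eq_one {x y : P.carrier} (h : [x, y] ∈ P.dom) (e : P.prod _ h = P.one) :
    y = P.inv x := by
  have h4 := P.inv_append_mem _ h
  have h3 : [P.inv x, x, y] ∈ P.dom := P.tail_mem (P.inv y) _ (by simpa using h4) (by simp)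
  have hx : [P.inv x, x] ∈ P.dom :=
    P.mem_of_append_left (w := [y]) (by simpa using h3) (by simp)
  obtain ⟨h5, e5⟩ := P.prod_eq_of_merge (u := []) (w := [y]) hx (P.inv_prod x hx)
    (s := [P.one, y]) h3 (by simp) (by simp)
  obtain ⟨h6, e6⟩ := P.prod_eq_of_merge (u := [P.inv x]) (w := []) h e
    (s := [P.inv x, P.one]) h3 (by simp) (by simp)
  rw [P.one_prod] at e5
  rw [P.prod_one] at e6
  exact e5.trans e6.symm

theorem mem_pair_inv (x : P.carrier) : [x, P.inv x] ∈ P.dom := by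
  simpa using P.append_inv_mem _ (P.singleton_mem x)

theorem mem_inv_pair (x : P.carrier) : [P.inv x, x] ∈ P.dom := by
  simpa using P.inv_append_mem _ (P.singleton_mem x)

theorem inv_inv (x : P.carrier) : P.inv (P.inv x) = x :=
  (P.eq_inv_of_prod_eq_one (P.mem_inv_pair x) (P.inv_prod x _)).symm

theorem inv_one : P.inv P.one = P.one := by
  have h : [P.one, P.one] ∈ P.dom := P.insert_one_mem [] [P.one] (P.singleton_mem _)
  exact (P.eq_inv_of_prod_eq_one h (P.one_prod _ h)).symm

theorem invWord_append (u v : List P.carrier) :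
    P.invWord (u ++ v) = P.invWord v ++ P.invWord u := by simp [invWord]

theorem invWord_cons (x : P.carrier) (v : List P.carrier) :
    P.invWord (x :: v) = P.invWord v ++ [P.inv x] := by simp [invWord]

theorem invWord_invWord (w : List P.carrier) : P.invWord (P.invWord w) = w := by
  simp [invWord, Function.comp_def, P.inv_inv]

theorem invWord_ne_nil {w : List P.carrier} (h : w ≠ []) : P.invWord w ≠ [] := by
  simpa [invWord] using h

theorem invWord_mem {w : List P.carrier} (h : w ∈ P.dom) : P.invWord w ∈ P.dom :=
  P.mem_of_append_left (P.inv_append_mem _ h) (P.invWord_ne_nil (P.ne_nil_of_mem h))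

theorem mem_of_invWord_mem {w : List P.carrier} (h : P.invWord w ∈ P.dom) : w ∈ P.dom := by
  simpa [P.invWord_invWord] using P.invWord_mem h

theorem prod_append_invWord (w : List P.carrier) (h : w ++ P.invWord w ∈ P.dom) :
    P.prod _ h = P.one := by
  induction w using List.reverseRecOn with
  | nil => exact absurd h P.nil_notMem
  | append_singleton u x ih =>
    obtain ⟨h1, e1⟩ := P.prod_eq_of_merge (u := u) (w := P.invWord u) (P.mem_pair_inv x)
      (P.prod_inv x _) h (by simp [invWord]) rfl
    rw [← e1]
    rcases eq_or_ne u [] with rfl | hu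
    · exact P.prod_singleton _
    · have hu' : u ∈ P.dom := P.mem_of_append_left (u := u) (w := [P.one] ++ P.invWord u)
        (by simpa using h1) hu
      obtain ⟨h2, e2⟩ := P.prod_insert_one (P.append_inv_mem u hu')
      exact e2.trans (ih _)

theorem prod_invWord {w : List P.carrier} (h : w ∈ P.dom) :
    P.prod _ (P.invWord_mem h) = P.inv (P.prod w h) := by
  obtain ⟨h1, e1⟩ := P.prod_eq_of_merge (u := []) (w := P.invWord w) h rfl
    (s := [P.prod w h] ++ P.invWord w) (P.append_inv_mem w h) (by simp [invWord]) (by simp)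
  obtain ⟨h2, e2⟩ := P.prod_eq_of_merge (u := [P.prod w h]) (w := []) (P.invWord_mem h) rfl
    (s := [P.prod w h, P.prod _ (P.invWord_mem h)]) h1 (by simp) (by simp)
  exact P.eq_inv_of_prod_eq_one h2 (by rw [e2, e1]; exact P.prod_append_invWord w _)

end Lemmas

/-! ### Groups as partial groups -/

/-- A group as a partial group: all nonempty words can be multiplied. -/
def ofGroup (G : Type u) [Group G] : PartialGroup.{u} where
  carrier := G
  dom := {w | w ≠ []}
  prod w _ := w.prod
  nil_notMem := by simp
  singleton_mem := by simp
  prod_singleton := by simp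
  tail_mem _ _ _ h := h
  dropLast_mem _ _ _ h := h
  assoc u v w _ _ := ⟨by simp, by simp⟩
  one := 1
  insert_one_mem := by simp
  one_prod := by simp
  prod_one := by simp
  inv := Inv.inv
  append_inv_mem := by simp
  inv_append_mem := by simp
  prod_inv := by simp
  inv_prod := by simp

/-- A group homomorphism as a map of partial groups. -/
def ofGroupHom {G G' : Type u} [Group G] [Group G'] (f : G →* G') : ofGroup G ⟶ ofGroup G' where
  toFun := f
  map_mem _ h e := h (List.map_eq_nil_iff.1 e)
  map_prod (w : List G) _ := (map_list_prod f w).symm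

/-! ### Parades -/

section Parade

variable {G₀ : Type u} [Group G₀] {X₀ : Type v} [MulAction G₀ᵐᵒᵖ X₀]

/-- `IsRoute X x (g₁, …, gₙ)`: all of `x, x g₁, x g₁ g₂, …, x g₁ ⋯ gₙ` lie in `X`. -/
def IsRoute (X : Set X₀) : X₀ → List G₀ → Prop
  | x, [] => x ∈ X
  | x, g :: w => x ∈ X ∧ IsRoute X (x <• g) w

theorem IsRoute.start {X : Set X₀} {x : X₀} {w : List G₀} (h : IsRoute X x w) : x ∈ X := by
  cases w with
  | nil => exact h
  | cons g w => exact h.1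

theorem isRoute_append {X : Set X₀} {x : X₀} {u w : List G₀} :
    IsRoute X x (u ++ w) ↔ IsRoute X x u ∧ IsRoute X (x <• u.prod) w := by
  induction u generalizing x with
  | nil =>
    simp only [List.nil_append, List.prod_nil, MulOpposite.op_one, one_smul]
    exact ⟨fun h => ⟨h.start, h⟩, fun h => h.2⟩
  | cons g u ih =>
    simp only [List.cons_append, IsRoute, ih, List.prod_cons, MulOpposite.op_mul, mul_smul,
      and_assoc]

theorem IsRoute.finish {X : Set X₀} {x : X₀} {w : List G₀} (h : IsRoute X x w) :
    x <• w.prod ∈ X := by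
  have : IsRoute X x (w ++ []) := by simpa using h
  exact (isRoute_append.1 this).2

theorem IsRoute.inv {X : Set X₀} {x : X₀} {w : List G₀} (h : IsRoute X x w) :
    IsRoute X (x <• w.prod) (w.map (·⁻¹)).reverse := by
  induction w generalizing x with
  | nil => simpa [IsRoute] using h
  | cons g w ih =>
    have h2 := ih h.2
    have e : x <• (g :: w).prod = (x <• g) <• w.prod := by
      simp [mul_smul]
    rw [e, List.map_cons, List.reverse_cons, isRoute_append]
    refine ⟨h2, ?_⟩
    have e2 : ((x <• g) <• w.prod) <• ((w.map (·⁻¹)).reverse).prod = x <• g := by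
      rw [← List.prod_inv_reverse, smul_smul, ← MulOpposite.op_mul]
      simp
    rw [e2]
    exact ⟨h.2.start, by simpa [IsRoute] using h.1⟩

variable (G₀) in
/-- The elements of `G₀` that are parades of length one in `X`. -/
abbrev ParadeCarrier (X : Set X₀) : Type u := {g : G₀ // ∃ x, IsRoute X x [g]}

theorem IsRoute.prod_single {X : Set X₀} {x : X₀} {w : List G₀} (h : IsRoute X x w) :
    IsRoute X x [w.prod] := ⟨h.start, h.finish⟩

variable (G₀) in
/-- The partial group of the parades in a nonempty subset `X` of a right `G₀`-set `X₀`: a nonempty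
word `(g₁, …, gₙ)` in `G₀` can be multiplied if there is some `x` such that all of
`x, x g₁, x g₁ g₂, …, x g₁ ⋯ gₙ` lie in `X`, and the product is that of `G₀`. -/
def parade (X : Set X₀) (hX : X.Nonempty) : PartialGroup.{u} where
  carrier := ParadeCarrier G₀ X
  dom := {w | w ≠ [] ∧ ∃ x, IsRoute X x (w.map Subtype.val)}
  prod w h := ⟨(w.map Subtype.val).prod, h.2.imp fun _ hx => hx.prod_single⟩
  nil_notMem := by simp
  singleton_mem g := ⟨by simp, g.2⟩
  prod_singleton g := by simp
  tail_mem g w h hw := by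
    obtain ⟨-, x, hx⟩ := h
    exact ⟨hw, _, hx.2⟩
  dropLast_mem w g h hw := by
    obtain ⟨-, x, hx⟩ := h
    rw [List.map_append, isRoute_append] at hx
    exact ⟨hw, x, hx.1⟩
  assoc u v w hv h := by
    obtain ⟨-, x, hx⟩ := h
    rw [List.map_append, List.map_append, isRoute_append, isRoute_append] at hx
    refine ⟨⟨by simp, x, ?_⟩, by simp⟩
    rw [List.map_append, List.map_append, isRoute_append, isRoute_append]
    refine ⟨⟨hx.1.1, by simpa using hx.1.2.prod_single⟩, ?_⟩
    simpa using hx.2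
  one := ⟨1, hX.choose, hX.choose_spec, by simpa [IsRoute] using hX.choose_spec⟩
  insert_one_mem u v h := by
    obtain ⟨-, x, hx⟩ := h
    rw [List.map_append, isRoute_append] at hx
    refine ⟨by simp, x, ?_⟩
    rw [List.append_assoc, List.map_append, isRoute_append]
    refine ⟨hx.1, ?_⟩
    change _ ∈ X ∧ IsRoute X (_ <• (1 : G₀)) (v.map Subtype.val)
    rw [MulOpposite.op_one, one_smul]
    exact ⟨hx.2.start, hx.2⟩
  one_prod g h := by simp
  prod_one g h := by simp
  inv g := ⟨g.1⁻¹, g.2.choose <• g.1, by simpa using g.2.choose_spec.inv⟩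
  append_inv_mem w h := by
    obtain ⟨hw, x, hx⟩ := h
    refine ⟨by simp [hw], x, ?_⟩
    rw [List.map_append, isRoute_append]
    refine ⟨hx, ?_⟩
    have := hx.inv
    rw [List.map_map] at this
    rw [List.map_reverse, List.map_map]
    exact this
  inv_append_mem w h := by
    obtain ⟨hw, x, hx⟩ := h
    refine ⟨by simp [hw], x <• (w.map Subtype.val).prod, ?_⟩
    rw [List.map_append, isRoute_append, List.map_reverse, List.map_map]
    have h1 := hx.inv
    have e : (w.map Subtype.val).map (·⁻¹) = w.map ((fun g : G₀ => g⁻¹) ∘ Subtype.val) := by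
      rw [List.map_map]
    rw [e] at h1
    refine ⟨h1, ?_⟩
    have e2 : (x <• (w.map Subtype.val).prod) <•
        ((w.map ((fun g : G₀ => g⁻¹) ∘ Subtype.val)).reverse).prod = x := by
      rw [← e, ← List.prod_inv_reverse, smul_smul, ← MulOpposite.op_mul]
      simp
    have e3 := e2.symm ▸ hx
    exact e3
  prod_inv g h := by simp
  inv_prod g h := by simp

end Parade

/-! ### Vector parades -/

/-- An additive group acts on itself from the right by translations `x ↦ x + a`. -/
instance translationAction (A : Type u) [AddGroup A] : MulAction (Multiplicative A)ᵐᵒᵖ A where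
  smul a x := x + a.unop.toAdd
  one_smul x := add_zero x
  mul_smul a b x := (add_assoc x b.unop.toAdd a.unop.toAdd).symm

/-- The partial group of vector parades generated by a nonempty set of points: its elements are
the differences `q - p` with `p, q ∈ P`, the words that can be multiplied are
`(p₁ - p₀, p₂ - p₁, …, pₙ - pₙ₋₁)` with all `pᵢ` in `P`, and the product of such a word
is `pₙ - p₀`. -/
def vectorParades {A : Type u} [AddGroup A] (P : Set A) (hP : P.Nonempty) : PartialGroup.{u} :=
  parade (Multiplicative A) P hP

/-- The partial group `𝒱({0,1})`. -/
def V01 : PartialGroup.{0} := vectorParades ({0, 1} : Set ℤ) ⟨0, by simp⟩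

/-! ### Actions on sets and on partial groups -/

/-- The structure of a right `P`-set on `X`. `dom x w` says that `(x | w)` belongs to `X Pₙ`,
where `n` is the length of `w`; for `n = 0` the convention is `X P₀ = X`, with the identity as
the action map. -/
structure PSet (P : PartialGroup.{u}) (X : Type v) where
  dom : X → List P.carrier → Prop
  act : (x : X) → (w : List P.carrier) → dom x w → X
  dom_mem : ∀ x w, dom x w → w ≠ [] → w ∈ P.dom
  dom_nil : ∀ x, dom x []
  act_nil : ∀ x, act x [] (dom_nil x) = x
  dropLast_dom : ∀ x w g, dom x (w ++ [g]) → dom x w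
  act_act : ∀ x w w' (hw : dom x w) (h : dom x (w ++ w')),
    ∃ h' : dom (act x w hw) w', act _ w' h' = act x (w ++ w') h
  act_assoc : ∀ x u v w (hv : v ∈ P.dom) (h : dom x (u ++ v ++ w)),
    ∃ h' : dom x (u ++ [P.prod v hv] ++ w), act x _ h' = act x _ h
  insert_one_dom : ∀ x u v, dom x (u ++ v) → dom x (u ++ [P.one] ++ v)
  act_one : ∀ x (h : dom x [P.one]), act x [P.one] h = x
  append_inv_dom : ∀ x w, dom x w → dom x (w ++ P.invWord w)

/-- Let `R` be the graph of a partially defined map `f` from `X` to `X`. Then this says that `f` is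
a map of `P`-sets: `f (x) ◁ w = f (x ◁ w)`, where the left-hand side is defined if `x ◁ w` is. -/
def PSet.Equivariant {P : PartialGroup.{u}} {X : Type v} (S : PSet P X) (R : X → X → Prop) :
    Prop :=
  ∀ x y, R x y → ∀ w (h : S.dom x w), ∃ h' : S.dom y w, R (S.act x w h) (S.act y w h')

/-- The graph of the map `id × prod × id`, on words `u ++ v ++ w` of `H` with `u` of length `p` and
`v` (nonempty) of length `q`. -/
def MergeRel (H : PartialGroup.{u}) (p q : ℕ) (x y : H.Word) : Prop :=
  ∃ (u v w : List H.carrier) (hv : v ∈ H.dom), u.length = p ∧ v.length = q ∧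
    x.1 = u ++ v ++ w ∧ y.1 = u ++ [H.prod v hv] ++ w

/-- The graph of the map that inserts the unit at position `i`. -/
def InsertOneRel (H : PartialGroup.{u}) (i : ℕ) (x y : H.Word) : Prop :=
  ∃ u v : List H.carrier, u.length = i ∧ x.1 = u ++ v ∧ y.1 = u ++ [H.one] ++ v

/-- The structure of an `F`-partial group on a partial group `H`: every `Hᵣ`, `r > 0`, is an
`F`-set (a length-preserving `F`-set structure on their disjoint union `H.Word`), and the
structure maps between the `Hᵣ` are maps of `F`-sets. -/
structure PGAction (F : PartialGroup.{u}) (H : PartialGroup.{u}) extends PSet F H.Word where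
  length_act : ∀ x w (h : dom x w), (act x w h).1.length = x.1.length
  tail_equivariant : toPSet.Equivariant fun x y => y.1 = x.1.tail
  dropLast_equivariant : toPSet.Equivariant fun x y => y.1 = x.1.dropLast
  merge_equivariant : ∀ p q, toPSet.Equivariant (MergeRel H p q)
  insert_one_equivariant : ∀ i, toPSet.Equivariant (InsertOneRel H i)
  dom_one : ∀ w ∈ F.dom, dom (H.single H.one) w
  act_one_left : ∀ w (h : dom (H.single H.one) w), act _ w h = H.single H.one
  append_inv_equivariant : toPSet.Equivariant fun x y => y.1 = x.1 ++ H.invWord x.1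
  inv_append_equivariant : toPSet.Equivariant fun x y => y.1 = H.invWord x.1 ++ x.1

/-! ### Semidirect products -/

namespace PGAction

variable {F H : PartialGroup.{u}} (S : PGAction F H)

theorem act_congr {x y : H.Word} {w w' : List F.carrier} (e : x = y) (e' : w = w')
    (h : S.dom x w) (h' : S.dom y w') : S.act x w h = S.act y w' h' := by
  subst e; subst e'; rfl

theorem act_single_ne_nil (x : H.carrier) (w : List F.carrier) (h : S.dom (H.single x) w) :
    (S.act (H.single x) w h).1 ≠ [] := fun e => H.nil_notMem (e ▸ (S.act (H.single x) w h).2)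

/-- The action `x ◁ w` on a single element of `H`. -/
def act₁ (x : H.carrier) (w : List F.carrier) (h : S.dom (H.single x) w) : H.carrier :=
  (S.act (H.single x) w h).1.head (S.act_single_ne_nil x w h)

/-- The underlying set of the semidirect product: the pairs `(γ, η)`, `γ ∈ F₁`, `η ∈ H₁`,
such that `(η | γ⁻¹) ∈ H₁ F₁`. -/
@[ext]
structure SemiCarrier : Type u where
  fst : F.carrier
  snd : H.carrier
  mem : S.dom (H.single snd) [F.inv fst]

variable {S}

/-- The condition `(ηⱼ | γⱼ₊₁, …, γₙ) ∈ H₁ Fₙ₋ⱼ` for all `j < n` on a word `(γ₁ ⋉ η₁, …, γₙ ⋉ ηₙ)`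
(for `j = n` it is vacuous). -/
def PreDom : List S.SemiCarrier → Prop
  | [] => True
  | a :: α => S.dom (H.single a.snd) (α.map SemiCarrier.fst) ∧ PreDom α

/-- The word `A (α) = (η₁ ◁ (γ₂, …, γₙ), η₂ ◁ (γ₃, …, γₙ), …, ηₙ₋₁ ◁ γₙ, ηₙ)`. -/
def A : (α : List S.SemiCarrier) → PreDom α → List H.carrier
  | [], _ => []
  | a :: α, h => S.act₁ a.snd (α.map SemiCarrier.fst) h.1 :: A α h.2

/-- The words `α` that can be multiplied in the semidirect product: those for which `A (α)` is
defined and `(A (α) | γₙ⁻¹, …, γ₁⁻¹) ∈ Hₙ Fₙ`. -/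
def SemiDom (α : List S.SemiCarrier) : Prop :=
  ∃ (h : PreDom α) (hA : A α h ∈ H.dom),
    S.dom ⟨A α h, hA⟩ (F.invWord (α.map SemiCarrier.fst))

/-! The remaining lemmas of this section show that the semidirect product is a partial group. -/

/-- `ξ ◁ w` is defined and equal to `ζ`. -/
def Act (S : PGAction F H) (ξ : List H.carrier) (w : List F.carrier) (ζ : List H.carrier) : Prop :=
  ∃ (hξ : ξ ∈ H.dom) (h : S.dom ⟨ξ, hξ⟩ w), (S.act ⟨ξ, hξ⟩ w h).1 = ζ

namespace Act

variable {ξ ζ χ : List H.carrier} {w : List F.carrier}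

theorem mem (h : S.Act ξ w ζ) : ξ ∈ H.dom := h.1

theorem mem_right (h : S.Act ξ w ζ) : ζ ∈ H.dom := by
  obtain ⟨hξ, h, rfl⟩ := h
  exact (S.act _ w h).2

theorem word_mem (h : S.Act ξ w ζ) (hw : w ≠ []) : w ∈ F.dom := S.dom_mem _ _ h.2.1 hw

theorem unique (h : S.Act ξ w ζ) (h' : S.Act ξ w χ) : ζ = χ := by
  obtain ⟨_, _, rfl⟩ := h
  obtain ⟨_, _, rfl⟩ := h'
  rfl

theorem length (h : S.Act ξ w ζ) : ζ.length = ξ.length := by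
  obtain ⟨_, h, rfl⟩ := h
  exact S.length_act _ _ h

theorem nil (h : ξ ∈ H.dom) : S.Act ξ [] ξ := ⟨h, S.dom_nil _, by rw [S.act_nil]⟩

theorem split {u v : List F.carrier} (h : S.Act ξ (u ++ v) ζ) :
    ∃ χ, S.Act ξ u χ ∧ S.Act χ v ζ := by
  obtain ⟨hξ, h, rfl⟩ := h
  have hu : S.dom ⟨ξ, hξ⟩ u := by
    induction v using List.reverseRecOn with
    | nil => simpa using h
    | append_singleton v x ih =>
      rw [← List.append_assoc] at h
      exact ih (S.dropLast_dom _ _ _ h)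
  obtain ⟨h', e⟩ := S.act_act _ u v hu h
  exact ⟨_, ⟨hξ, hu, rfl⟩, (S.act _ u hu).2, h', by rw [← e]⟩

theorem of_append {u v : List F.carrier} (h : S.Act ξ (u ++ v) ζ) (hu : S.Act ξ u χ) :
    S.Act χ v ζ := by
  obtain ⟨χ', h1, h2⟩ := h.split
  rwa [hu.unique h1]

theorem merge_word {u v w : List F.carrier} (h : S.Act ξ (u ++ v ++ w) ζ) (hv : v ∈ F.dom) :
    S.Act ξ (u ++ [F.prod v hv] ++ w) ζ := by
  obtain ⟨hξ, h, rfl⟩ := h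
  obtain ⟨h', e⟩ := S.act_assoc _ u v w hv h
  exact ⟨hξ, h', by rw [e]⟩

theorem one_word (h : S.Act ξ [F.one] ζ) : ζ = ξ := by
  obtain ⟨hξ, h, rfl⟩ := h
  rw [S.act_one]

theorem insert_one_word {u v : List F.carrier} (h : S.Act ξ (u ++ v) ζ) :
    S.Act ξ (u ++ [F.one] ++ v) ζ := by
  obtain ⟨hξ, hd, -⟩ := id h
  have h1 : S.Act ξ (u ++ [F.one] ++ v) _ := ⟨hξ, S.insert_one_dom _ u v hd, rfl⟩
  obtain ⟨χ, h2, h3⟩ := h1.split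
  obtain ⟨χ', h4, h5⟩ := h2.split
  have e := h5.one_word
  subst e
  rw [(h.of_append h4).unique h3]
  exact h1

theorem append_inv (h : S.Act ξ w ζ) : S.Act ξ (w ++ F.invWord w) ξ := by
  obtain ⟨hξ, hd, -⟩ := id h
  have h1 : S.Act ξ (w ++ F.invWord w) _ := ⟨hξ, S.append_inv_dom _ w hd, rfl⟩
  rcases eq_or_ne w [] with rfl | hw
  · exact nil hξ
  · have hm : w ++ F.invWord w ∈ F.dom := h1.word_mem (by simp [hw])
    have h2 : S.Act ξ ([] ++ [F.prod _ hm] ++ []) _ :=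
      merge_word (u := []) (w := []) (by simpa using h1) hm
    rw [F.prod_append_invWord w hm] at h2
    have e := one_word (by simpa using h2)
    rw [e] at h1
    exact h1

theorem inv (h : S.Act ξ w ζ) : S.Act ζ (F.invWord w) ξ := h.append_inv.of_append h

theorem cancel {u v : List F.carrier} (h : S.Act ξ (u ++ v ++ F.invWord v) ζ) : S.Act ξ u ζ := by
  obtain ⟨χ, h1, h2⟩ := h.split
  obtain ⟨χ', h3, h4⟩ := h1.split
  rwa [h2.unique h4.inv]

theorem tail {x : H.carrier} (h : S.Act (x :: ξ) w ζ) (hξ : ξ ≠ []) : S.Act ξ w ζ.tail := by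
  obtain ⟨h1, h2, rfl⟩ := h
  have hm := H.tail_mem _ _ h1 hξ
  obtain ⟨h3, e⟩ := S.tail_equivariant ⟨_, h1⟩ ⟨ξ, hm⟩ rfl w h2
  exact ⟨hm, h3, e⟩

theorem dropLast {x : H.carrier} (h : S.Act (ξ ++ [x]) w ζ) (hξ : ξ ≠ []) :
    S.Act ξ w ζ.dropLast := by
  obtain ⟨h1, h2, rfl⟩ := h
  have hm := H.dropLast_mem _ _ h1 hξ
  obtain ⟨h3, e⟩ := S.dropLast_equivariant ⟨_, h1⟩ ⟨ξ, hm⟩ (by simp) w h2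
  exact ⟨hm, h3, e⟩

theorem suffix {u : List H.carrier} (h : S.Act (u ++ ξ) w ζ) (hξ : ξ ≠ []) :
    S.Act ξ w (ζ.drop u.length) := by
  induction u generalizing ζ with
  | nil => simpa using h
  | cons x u ih => simpa using ih (h.tail (by simp [hξ]))

theorem pre {v : List H.carrier} (h : S.Act (ξ ++ v) w ζ) (hξ : ξ ≠ []) :
    S.Act ξ w (ζ.take ξ.length) := by
  induction v using List.reverseRecOn generalizing ζ with
  | nil =>
    have := h.length
    simp only [List.append_nil] at this h
    rwa [← this, List.take_length]
  | append_singleton v x ih =>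
    rw [← List.append_assoc] at h
    have h1 := ih (h.dropLast (by simp [hξ]))
    have h2 := h.length
    rw [List.dropLast_eq_take, List.take_take, min_eq_left] at h1
    · exact h1
    · simp at h2
      omega

theorem of_mem (h : S.Act ξ w ζ) {x : H.carrier} (hx : x ∈ ξ) : ∃ y, S.Act [x] w [y] := by
  obtain ⟨u, v, rfl⟩ := List.append_of_mem hx
  have h1 := h.suffix (by simp)
  have h2 : S.Act ([x] ++ v) w _ := h1
  have h3 := h2.pre (by simp)
  have h4 := h3.length
  obtain ⟨y, hy⟩ := List.length_eq_one_iff.1 h4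
  exact ⟨y, hy ▸ h3⟩

theorem cons_inv {x : H.carrier} (h : S.Act (x :: ξ) w ζ) :
    ∃ y, S.Act [x] w [y] ∧ ζ = y :: ζ.tail := by
  have h2 : S.Act ([x] ++ ξ) w ζ := h
  have h3 := h2.pre (by simp)
  have h4 := h.length
  rcases ζ with _ | ⟨y, ζ⟩
  · simp at h4
  · exact ⟨y, by simpa using h3, rfl⟩

theorem merge {u v t : List H.carrier} (h : S.Act (u ++ v ++ t) w ζ) (hv : v ∈ H.dom) :
    ∃ u' v' t' hv', u'.length = u.length ∧ v'.length = v.length ∧ ζ = u' ++ v' ++ t' ∧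
      S.Act (u ++ [H.prod v hv] ++ t) w (u' ++ [H.prod v' hv'] ++ t') := by
  obtain ⟨h1, h2, rfl⟩ := h
  obtain ⟨hm, -⟩ := H.assoc u v t hv h1
  obtain ⟨h3, u', v', t', hv', e1, e2, e3, e4⟩ := S.merge_equivariant u.length v.length ⟨_, h1⟩
    ⟨_, hm⟩ ⟨u, v, t, hv, rfl, rfl, rfl, rfl⟩ w h2
  exact ⟨u', v', t', hv', e1, e2, e3, hm, h3, e4⟩

theorem prod (h : S.Act ξ w ζ) : S.Act [H.prod ξ h.mem] w [H.prod ζ h.mem_right] := by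
  have h0 : S.Act ([] ++ ξ ++ []) w ζ := by simpa using h
  obtain ⟨u', v', t', hv', e1, e2, e3, h1⟩ := h0.merge h.mem
  have hl := h.length
  obtain rfl : u' = [] := by simpa using e1
  obtain rfl : t' = [] := by
    have := congrArg List.length e3
    simp at this
    rw [← List.length_eq_zero_iff]
    omega
  obtain rfl : v' = ζ := by simpa using e3.symm
  simpa using h1

theorem insert_one {u v : List H.carrier} (h : S.Act (u ++ v) w ζ) :
    ∃ ζ', S.Act (u ++ [H.one] ++ v) w ζ' := by
  obtain ⟨h1, h2, -⟩ := h
  have hm := H.insert_one_mem u v h1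
  obtain ⟨h3, -⟩ := S.insert_one_equivariant u.length ⟨_, h1⟩ ⟨_, hm⟩ ⟨u, v, rfl, rfl, rfl⟩ w h2
  exact ⟨_, hm, h3, rfl⟩

theorem one_single (hw : w = [] ∨ w ∈ F.dom) : S.Act [H.one] w [H.one] := by
  rcases hw with rfl | hw
  · exact nil (H.singleton_mem _)
  · exact ⟨H.singleton_mem _, S.dom_one w hw, congrArg Subtype.val (S.act_one_left w _)⟩

theorem invWord_append (h : S.Act ξ w ζ) : S.Act (H.invWord ξ ++ ξ) w (H.invWord ζ ++ ζ) := by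
  obtain ⟨h1, h2, rfl⟩ := h
  have hm := H.inv_append_mem _ h1
  obtain ⟨h3, e⟩ := S.inv_append_equivariant ⟨_, h1⟩ ⟨_, hm⟩ rfl w h2
  exact ⟨hm, h3, e⟩

theorem inv_single {x y : H.carrier} (h : S.Act [x] w [y]) : S.Act [H.inv x] w [H.inv y] := by
  have h1 := h.invWord_append
  have h2 : S.Act ([H.inv x] ++ [x]) w [H.inv y, y] := by simpa [invWord] using h1
  simpa using h2.pre (by simp)

theorem exists_single {x : H.carrier} (h : S.dom (H.single x) w) : S.Act [x] w [S.act₁ x w h] := by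
  refine ⟨H.singleton_mem x, h, ?_⟩
  have h1 := S.length_act _ _ h
  obtain ⟨y, hy⟩ := List.length_eq_one_iff.1 (h1.trans rfl)
  have hy' : (S.act (H.single x) w h).1 = [y] := hy
  have e : S.act₁ x w h = y := by
    simp only [act₁, hy', List.head_cons]
  rw [e]
  exact hy'

theorem dom_single {x y : H.carrier} (h : S.Act [x] w [y]) : S.dom (H.single x) w := h.2.1

theorem act₁_eq {x y : H.carrier} (h : S.Act [x] w [y]) (h' : S.dom (H.single x) w) :
    S.act₁ x w h' = y := by
  simpa using (exists_single h').unique h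

end Act

/-- The word `(γₙ⁻¹, …, γ₁⁻¹)`. -/
def bar (α : List S.SemiCarrier) : List F.carrier := F.invWord (α.map SemiCarrier.fst)

theorem bar_append (α β : List S.SemiCarrier) : bar (α ++ β) = bar β ++ bar α := by
  simp [bar, F.invWord_append]

theorem bar_cons (a : S.SemiCarrier) (α : List S.SemiCarrier) :
    bar (a :: α) = bar α ++ [F.inv a.fst] := by
  simp [bar, F.invWord_cons]

/-- `α` consists of the elements `γᵢ ⋉ (ξᵢ ◁ g × (γₙ⁻¹, …, γᵢ₊₁⁻¹))`. -/
def Spine (g : List F.carrier) : List H.carrier → List S.SemiCarrier → Prop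
  | [], [] => True
  | x :: ξ, a :: α => S.Act [x] (g ++ bar α) [a.snd] ∧ Spine g ξ α
  | _, _ => False

namespace Spine

variable {g : List F.carrier} {ξ : List H.carrier} {α β : List S.SemiCarrier}

theorem length (h : Spine g ξ α) : ξ.length = α.length := by
  induction α generalizing ξ with
  | nil => cases ξ with
    | nil => rfl
    | cons x ξ => exact h.elim
  | cons a α ih => cases ξ with
    | nil => exact h.elim
    | cons x ξ => simpa using ih h.2

theorem append_iff {χ : List H.carrier} (e : ξ.length = α.length) :
    Spine g (ξ ++ χ) (α ++ β) ↔ Spine (g ++ bar β) ξ α ∧ Spine g χ β := by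
  induction α generalizing ξ with
  | nil =>
    obtain rfl : ξ = [] := by simpa using e
    simp [Spine]
  | cons a α ih => cases ξ with
    | nil => simp at e
    | cons x ξ =>
      simp only [List.cons_append, Spine, ih (by simpa using e), bar_append, List.append_assoc,
        and_assoc]

theorem split (h : Spine g ξ (α ++ β)) :
    ∃ ξ₁ ξ₂, ξ = ξ₁ ++ ξ₂ ∧ ξ₁.length = α.length ∧ ξ₂.length = β.length ∧
      Spine (g ++ bar β) ξ₁ α ∧ Spine g ξ₂ β := by
  have hl := h.length
  have e : (ξ.take α.length).length = α.length := by
    simp at hl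
    simp [hl]
  rw [← List.take_append_drop α.length ξ, append_iff e] at h
  exact ⟨_, _, (List.take_append_drop α.length ξ).symm, e, h.2.length, h⟩

theorem mono {g' : List F.carrier} (h : Spine g ξ α)
    (hg : ∀ x ∈ ξ, ∀ y v, S.Act [x] (g ++ v) [y] → S.Act [x] (g' ++ v) [y]) : Spine g' ξ α := by
  induction α generalizing ξ with
  | nil => cases ξ with
    | nil => trivial
    | cons x ξ => exact h.elim
  | cons a α ih => cases ξ with
    | nil => exact h.elim
    | cons x ξ =>
      exact ⟨hg x (by simp) _ _ h.1, ih h.2 fun y hy => hg y (by simp [hy])⟩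

theorem shift {g' : List F.carrier} {ζ : List H.carrier} (h : Spine (g ++ g') ξ α)
    (hζ : S.Act ξ g ζ) : Spine g' ζ α := by
  induction α generalizing ξ ζ with
  | nil => cases ξ with
    | nil => exact absurd hζ.mem H.nil_notMem
    | cons x ξ => exact h.elim
  | cons a α ih => cases ξ with
    | nil => exact h.elim
    | cons x ξ =>
      obtain ⟨y, hy, e⟩ := hζ.cons_inv
      rw [e]
      have h1 := h.1
      rw [List.append_assoc] at h1
      refine ⟨h1.of_append hy, ?_⟩
      rcases eq_or_ne ξ [] with rfl | hξ
      · have hl := hζ.length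
        have ht : ζ.tail = [] := by
          rw [← List.length_eq_zero_iff]; simp [hl]
        rw [ht]
        cases α with
        | nil => trivial
        | cons b α => exact h.2.elim
      · exact ih h.2 (hζ.tail hξ)

theorem of_preDom (h : PreDom α) : Spine [] (A α h) α := by
  induction α with
  | nil => trivial
  | cons a α ih => exact ⟨(Act.exists_single h.1).inv, ih h.2⟩

theorem preDom (h : Spine [] ξ α) : PreDom α := by
  induction α generalizing ξ with
  | nil => trivial
  | cons a α ih => cases ξ with
    | nil => exact h.elim
    | cons x ξ =>
      have h1 := h.1.inv
      rw [List.nil_append, bar, F.invWord_invWord] at h1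
      exact ⟨h1.dom_single, ih h.2⟩

theorem unique {ζ : List H.carrier} (h : Spine [] ξ α) (h' : Spine [] ζ α) : ξ = ζ := by
  induction α generalizing ξ ζ with
  | nil =>
    have e1 := h.length
    have e2 := h'.length
    simp at e1 e2
    rw [e1, e2]
  | cons a α ih => cases ξ with
    | nil => exact h.elim
    | cons x ξ => cases ζ with
      | nil => exact h'.elim
      | cons y ζ =>
        have e := h.1.inv.unique h'.1.inv
        rw [ih h.2 h'.2]
        simpa using e

theorem A_eq (h : Spine [] ξ α) (h' : PreDom α) : A α h' = ξ := (of_preDom h').unique h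

end Spine

theorem semiDom_iff {α : List S.SemiCarrier} :
    SemiDom α ↔ ∃ ξ ζ, Spine [] ξ α ∧ S.Act ξ (bar α) ζ := by
  constructor
  · rintro ⟨h, hA, hd⟩
    exact ⟨_, _, Spine.of_preDom h, hA, hd, rfl⟩
  · rintro ⟨ξ, ζ, h, ha⟩
    rw [← h.A_eq h.preDom] at ha
    exact ⟨h.preDom, ha.1, ha.2.1⟩

theorem semiDom_of {α : List S.SemiCarrier} {ξ ζ : List H.carrier} (h : Spine [] ξ α)
    (h' : S.Act ξ (bar α) ζ) : SemiDom α := semiDom_iff.2 ⟨ξ, ζ, h, h'⟩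

theorem SemiDom.act {α : List S.SemiCarrier} (h : SemiDom α) :
    ∃ ζ, S.Act (A α h.1) (bar α) ζ := ⟨_, h.2.1, h.2.2, rfl⟩

theorem SemiDom.ne_nil {α : List S.SemiCarrier} (h : SemiDom α) : α ≠ [] := by
  rintro rfl
  exact H.nil_notMem h.2.1

theorem SemiDom.bar_mem {α : List S.SemiCarrier} (h : SemiDom α) : bar α ∈ F.dom := by
  obtain ⟨ζ, hζ⟩ := h.act
  exact hζ.word_mem (F.invWord_ne_nil (by simpa using h.ne_nil))

theorem SemiDom.fst_mem {α : List S.SemiCarrier} (h : SemiDom α) :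
    α.map SemiCarrier.fst ∈ F.dom := F.mem_of_invWord_mem h.bar_mem

theorem SemiDom.prod_mem {α : List S.SemiCarrier} (h : SemiDom α) :
    S.dom (H.single (H.prod (A α h.1) h.2.1)) [F.inv (F.prod _ h.fst_mem)] := by
  obtain ⟨ζ, hζ⟩ := h.act
  have h1 := hζ.prod
  have h2 : S.Act _ ([] ++ [F.prod _ h.bar_mem] ++ []) _ :=
    Act.merge_word (by simpa using h1) h.bar_mem
  have e : F.prod _ h.bar_mem = F.inv (F.prod _ h.fst_mem) := F.prod_invWord h.fst_mem
  rw [e] at h2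
  exact Act.dom_single (by simpa using h2)

/-- The product `(γ₁ ⋯ γₙ) ⋉ (A (α)₁ ⋯ A (α)ₙ)` in the semidirect product. -/
def semiProd (α : List S.SemiCarrier) (h : SemiDom α) : S.SemiCarrier :=
  ⟨F.prod (α.map SemiCarrier.fst) h.fst_mem, H.prod (A α h.1) h.2.1, h.prod_mem⟩

theorem act_inv_snd (a : S.SemiCarrier) :
    S.Act [H.inv a.snd] [F.inv a.fst] [H.inv (S.act₁ a.snd [F.inv a.fst] a.mem)] :=
  (Act.exists_single a.mem).inv_single

/-- The inverse `γ⁻¹ ⋉ (η⁻¹ ◁ γ⁻¹)` in the semidirect product. -/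
def semiInv (a : S.SemiCarrier) : S.SemiCarrier :=
  ⟨F.inv a.fst, S.act₁ (H.inv a.snd) [F.inv a.fst] (act_inv_snd a).dom_single, by
    have h := (Act.exists_single (act_inv_snd a).dom_single).inv
    exact Act.dom_single (by simpa [invWord] using h)⟩

/-- The unit `1 ⋉ 1` of the semidirect product. -/
def semiOne : S.SemiCarrier :=
  ⟨F.one, H.one, S.dom_one _ (F.singleton_mem _)⟩

theorem semiInv_snd (a : S.SemiCarrier) :
    (semiInv a).snd = H.inv (S.act₁ a.snd [F.inv a.fst] a.mem) :=
  (act_inv_snd a).act₁_eq _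

theorem semiInv_semiInv (a : S.SemiCarrier) : semiInv (semiInv a) = a := by
  refine SemiCarrier.ext (F.inv_inv _) ?_
  have h1 := (Act.exists_single (act_inv_snd a).dom_single).inv.inv_single
  rw [H.inv_inv] at h1
  exact Act.act₁_eq (by simpa [invWord, semiInv] using h1) _

theorem map_fst_inv (α : List S.SemiCarrier) :
    ((α.map semiInv).reverse).map SemiCarrier.fst = bar α := by
  simp [bar, invWord, semiInv, Function.comp_def]

theorem spine_inv {ξ : List H.carrier} {α : List S.SemiCarrier} (h : Spine [] ξ α)
    (t : List F.carrier) (ht : ∀ x ∈ ξ, ∃ y,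
      S.Act [H.inv x] (bar α ++ t ++ F.invWord t ++ F.invWord (bar α)) [y]) :
    Spine (bar α ++ t ++ F.invWord t) (H.invWord ξ) (α.map semiInv).reverse := by
  induction α generalizing ξ t with
  | nil =>
    obtain rfl : ξ = [] := by simpa using h.length
    trivial
  | cons a α ih => cases ξ with
    | nil => exact h.elim
    | cons x ξ =>
      rw [H.invWord_cons, List.map_cons, List.reverse_cons,
        Spine.append_iff (by simp [invWord, h.2.length])]
      constructor
      · have := ih h.2 ([F.inv a.fst] ++ t) fun y hy => by
          obtain ⟨z, hz⟩ := ht y (by simp [hy])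
          exact ⟨z, by simpa [bar_cons, invWord] using hz⟩
        simpa [bar_cons, invWord, bar, semiInv] using this
      · obtain ⟨y, hy⟩ := ht x (by simp)
        obtain ⟨χ, h1, -⟩ := hy.split
        have h2 := h1.cancel
        have h3 := h.1.inv_single
        rw [bar_cons] at h2
        have h4 := h2.of_append (by simpa using h3)
        have h5 := h4.unique (Act.exists_single (act_inv_snd a).dom_single)
        subst h5
        refine ⟨?_, trivial⟩
        simpa [bar, invWord, semiInv] using h1

theorem semiDom_tail (a : S.SemiCarrier) (α : List S.SemiCarrier) (h : SemiDom (a :: α))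
    (hα : α ≠ []) : SemiDom α := by
  obtain ⟨ξ, ζ, h1, h2⟩ := semiDom_iff.1 h
  cases ξ with
  | nil => exact h1.elim
  | cons x ξ =>
    have hξ : ξ ≠ [] := by
      rintro rfl
      exact hα (List.length_eq_zero_iff.1 h1.2.length.symm)
    have h3 := h2.tail hξ
    rw [bar_cons] at h3
    obtain ⟨χ, h4, -⟩ := h3.split
    exact semiDom_iff.2 ⟨_, _, h1.2, h4⟩

theorem semiDom_dropLast (α : List S.SemiCarrier) (b : S.SemiCarrier) (h : SemiDom (α ++ [b]))
    (hα : α ≠ []) : SemiDom α := by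
  obtain ⟨ξ, ζ, h1, h2⟩ := semiDom_iff.1 h
  obtain ⟨ξ₁, ξ₂, rfl, e1, e2, h3, -⟩ := h1.split
  have hξ : ξ₁ ≠ [] := by
    rintro rfl
    exact hα (List.length_eq_zero_iff.1 e1.symm)
  have h4 := h2.pre hξ
  rw [bar_append] at h4
  obtain ⟨χ, h5, h6⟩ := h4.split
  exact semiDom_iff.2 ⟨χ, _, Spine.shift (g' := []) (by simpa using h3) h5, h6⟩

theorem semi_assoc (u v w : List S.SemiCarrier) (hv : SemiDom v) (h : SemiDom (u ++ v ++ w)) :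
    ∃ h' : SemiDom (u ++ [semiProd v hv] ++ w), semiProd _ h' = semiProd _ h := by
  obtain ⟨ξ, ζ, h1, h2⟩ := semiDom_iff.1 h
  obtain ⟨ξ', ξw, rfl, e1, ew, h3, hw⟩ := h1.split
  obtain ⟨ξu, ξv, rfl, eu, ev, hu, hv'⟩ := h3.split
  have hξv : ξv ≠ [] := by
    rintro rfl
    exact hv.ne_nil (List.length_eq_zero_iff.1 ev.symm)
  have eb : F.prod _ hv.bar_mem = F.inv (F.prod _ hv.fst_mem) := F.prod_invWord hv.fst_mem
  have ebar : bar (S := S) [semiProd v hv] = [F.prod _ hv.bar_mem] := by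
    rw [eb]; simp [bar, invWord, semiProd]
  rw [bar_append, bar_append] at h2
  obtain ⟨χ, h4, -⟩ := ((h2.pre (ξ := ξu ++ ξv) (by simp [hξv])).suffix hξv).split
  have hs : Spine [] χ v := Spine.shift (g' := []) (by simpa using hv') h4
  have eχ := hs.A_eq hv.1
  have hm : ξv ∈ H.dom := h4.mem
  have hp := h4.prod
  have hsp : Spine [] (ξu ++ [H.prod ξv hm] ++ ξw) (u ++ [semiProd v hv] ++ w) := by
    rw [Spine.append_iff (by simp [eu]), Spine.append_iff eu]
    refine ⟨⟨?_, ?_, trivial⟩, hw⟩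
    · rw [ebar]
      refine Spine.mono hu fun x _ y t hx => ?_
      exact Act.merge_word (by simpa using hx) hv.bar_mem
    · have : (semiProd v hv).snd = H.prod χ h4.mem_right := by
        change H.prod _ _ = _
        exact H.prod_congr eχ _ _
      rw [this]
      simpa [bar, invWord] using hp
  obtain ⟨u', v', t', hv'', -, -, -, h5⟩ := h2.merge hm
  rw [← List.append_assoc] at h5
  have h6 := h5.merge_word hv.bar_mem
  have h' : SemiDom (u ++ [semiProd v hv] ++ w) := by
    refine semiDom_of hsp (ζ := u' ++ [H.prod v' hv''] ++ t') ?_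
    rw [bar_append, bar_append, ebar, ← List.append_assoc]
    exact h6
  refine ⟨h', SemiCarrier.ext ?_ ?_⟩
  · obtain ⟨h7, e7⟩ := F.assoc (u.map SemiCarrier.fst) (v.map SemiCarrier.fst)
      (w.map SemiCarrier.fst) hv.fst_mem (by simpa using h.fst_mem)
    refine (F.prod_congr ?_ _ h7).trans (e7.trans (F.prod_congr ?_ _ _))
    · simp [semiProd]
    · simp
  · obtain ⟨h7, e7⟩ := H.assoc ξu ξv ξw hm h2.mem
    refine (H.prod_congr (hsp.A_eq _) _ h7).trans (e7.trans (H.prod_congr (h1.A_eq _).symm _ _))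

theorem semiDom_insert_one (u v : List S.SemiCarrier) (h : SemiDom (u ++ v)) :
    SemiDom (u ++ [semiOne] ++ v) := by
  obtain ⟨ξ, ζ, h1, h2⟩ := semiDom_iff.1 h
  obtain ⟨ξu, ξv, rfl, eu, ev, hu, hv⟩ := h1.split
  obtain ⟨ζ', h3⟩ := h2.insert_one
  have e1 : bar (S := S) [semiOne] = [F.one] := by simp [bar, invWord, semiOne, F.inv_one]
  rw [bar_append] at h3
  refine semiDom_of (ξ := ξu ++ [H.one] ++ ξv) (ζ := ζ') ?_ ?_
  · rw [Spine.append_iff (by simp [eu]), Spine.append_iff eu]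
    refine ⟨⟨?_, ?_, trivial⟩, hv⟩
    · rw [e1]
      refine Spine.mono hu fun x _ y t hx => ?_
      exact Act.insert_one_word (by simpa using hx)
    · have hb : bar v = [] ∨ bar v ∈ F.dom := by
        rcases eq_or_ne (bar v) [] with hb | hb
        · exact Or.inl hb
        · obtain ⟨χ, h4, -⟩ := h3.split
          exact Or.inr (h4.word_mem hb)
      have : bar (S := S) [] = [] := rfl
      rw [this, List.append_nil, List.nil_append]
      exact Act.one_single hb
  · rw [bar_append, bar_append, e1, ← List.append_assoc]
    exact h3.insert_one_word

theorem semiDom_inv_append (α : List S.SemiCarrier) (h : SemiDom α) :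
    SemiDom ((α.map semiInv).reverse ++ α) := by
  obtain ⟨ξ, ζ, h1, h2⟩ := semiDom_iff.1 h
  have h3 := h2.invWord_append.append_inv
  have hξ : ξ ≠ [] := H.ne_nil_of_mem h2.mem
  have h4 := h3.pre (H.invWord_ne_nil hξ)
  refine semiDom_iff.2 ⟨H.invWord ξ ++ ξ, H.invWord ξ ++ ξ, ?_, ?_⟩
  · rw [Spine.append_iff (by simp [invWord, h1.length])]
    refine ⟨?_, h1⟩
    have := spine_inv h1 [] fun x hx => by
      obtain ⟨y, hy⟩ := h4.of_mem (x := H.inv x) (by simpa [invWord] using ⟨x, hx, rfl⟩)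
      exact ⟨y, by simpa [invWord] using hy⟩
    simpa [invWord] using this
  · rw [bar_append]
    have : bar (α.map semiInv).reverse = F.invWord (bar α) := by
      rw [← map_fst_inv α]; rfl
    rw [this]
    exact h3

theorem semiDom_append_inv (α : List S.SemiCarrier) (h : SemiDom α) :
    SemiDom (α ++ (α.map semiInv).reverse) := by
  have h1 := semiDom_inv_append α h
  have h2 : SemiDom (α.map semiInv).reverse := by
    have key : ∀ (β γ : List S.SemiCarrier), SemiDom (β ++ γ) → β ≠ [] → SemiDom β := by
      intro β γ hβ hn
      induction γ using List.reverseRecOn with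
      | nil => simpa using hβ
      | append_singleton γ x ih =>
        rw [← List.append_assoc] at hβ
        exact ih (semiDom_dropLast _ _ hβ (by simp [hn]))
    exact key _ _ h1 (by simpa using h.ne_nil)
  have h3 := semiDom_inv_append _ h2
  simpa [Function.comp_def, semiInv_semiInv] using h3

theorem act₁_nil (x : H.carrier) (h : S.dom (H.single x) []) : S.act₁ x [] h = x :=
  Act.act₁_eq (Act.nil (H.singleton_mem x)) h

theorem act₁_one (x : H.carrier) (h : S.dom (H.single x) [F.one]) : S.act₁ x [F.one] h = x := by
  simpa using (Act.exists_single h).one_word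

theorem act₁_of_one (γ : F.carrier) (h : S.dom (H.single H.one) [γ]) :
    S.act₁ H.one [γ] h = H.one :=
  Act.act₁_eq (Act.one_single (Or.inr (F.singleton_mem γ))) h

theorem semiDom_singleton (a : S.SemiCarrier) : SemiDom [a] := by
  refine semiDom_of (ξ := [a.snd]) (ζ := [S.act₁ a.snd [F.inv a.fst] a.mem])
    ⟨Act.nil (H.singleton_mem _), trivial⟩ ?_
  exact Act.exists_single a.mem

variable (S) in
/-- The semidirect product `F ⋉ H` of an `F`-partial group `H` by `F`. -/
def semidirect : PartialGroup.{u} where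
  carrier := S.SemiCarrier
  dom := {α | SemiDom α}
  prod := semiProd
  nil_notMem h := h.ne_nil rfl
  singleton_mem := semiDom_singleton
  prod_singleton a := by
    refine SemiCarrier.ext (F.prod_singleton _) ?_
    refine (H.prod_congr ?_ _ (H.singleton_mem _)).trans (H.prod_singleton _)
    simp [A, act₁_nil]
  tail_mem := semiDom_tail
  dropLast_mem := semiDom_dropLast
  assoc := semi_assoc
  one := semiOne
  insert_one_mem := semiDom_insert_one
  one_prod a h := by
    have h2 : [H.one, a.snd] ∈ H.dom := H.insert_one_mem [] _ (H.singleton_mem _)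
    refine SemiCarrier.ext (F.one_prod _ _) ((H.prod_congr ?_ _ h2).trans (H.one_prod _ _))
    simp [A, act₁_nil, semiOne, act₁_of_one]
  prod_one a h := by
    have h2 : [a.snd, H.one] ∈ H.dom := H.insert_one_mem [a.snd] [] (H.singleton_mem _)
    refine SemiCarrier.ext (F.prod_one _ _) ((H.prod_congr ?_ _ h2).trans (H.prod_one _ _))
    simp [A, act₁_nil, semiOne, act₁_one]
  inv := semiInv
  append_inv_mem := semiDom_append_inv
  inv_append_mem := semiDom_inv_append
  prod_inv a h := by
    refine SemiCarrier.ext (F.prod_inv _ _)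
      ((H.prod_congr ?_ _ (H.mem_pair_inv (S.act₁ a.snd [F.inv a.fst] a.mem))).trans
        (H.prod_inv _ _))
    change [_, S.act₁ (semiInv a).snd [] _] = _
    rw [act₁_nil, semiInv_snd]
    rfl
  inv_prod a h := by
    refine SemiCarrier.ext (F.inv_prod _ _)
      ((H.prod_congr ?_ _ (H.mem_inv_pair a.snd)).trans (H.inv_prod _ _))
    have h1 := (Act.exists_single (act_inv_snd a).dom_single).inv
    have h2 : S.Act [(semiInv a).snd] [a.fst] [H.inv a.snd] := by
      simpa [invWord, F.inv_inv, semiInv] using h1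
    change [S.act₁ (semiInv a).snd [a.fst] _, S.act₁ a.snd [] _] = _
    rw [act₁_nil, h2.act₁_eq]

end PGAction

end PartialGroup

/-! ## Figures -/

namespace Figure

open PartialGroup

/-- The Euclidean space `ℝᵈ`. -/
abbrev E (d : ℕ) : Type := EuclideanSpace ℝ (Fin d)

/-- The group of isometries of `ℝᵈ`, acting from the right: the product `a * b` is `a`
followed by `b`. -/
def EucGroup (d : ℕ) : Type := (E d ≃ᵢ E d)ᵐᵒᵖ

/-- The group of similarity transformations of `ℝᵈ` (the bijections that multiply all distances by
the same positive factor), acting from the right: the product `a * b` is `a` followed by `b`. -/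
def SimGroup (d : ℕ) : Type := (E d ≃ᵈ E d)ᵐᵒᵖ

noncomputable instance (d : ℕ) : Group (EucGroup d) := inferInstanceAs (Group (E d ≃ᵢ E d)ᵐᵒᵖ)

noncomputable instance (d : ℕ) : Group (SimGroup d) := inferInstanceAs (Group (E d ≃ᵈ E d)ᵐᵒᵖ)

/-- The similarity transformation given by an isometry. -/
noncomputable def eucToSim (d : ℕ) : EucGroup d →* SimGroup d where
  toFun a := MulOpposite.op (MulOpposite.unop a).toDilationEquiv
  map_one' := rfl
  map_mul' _ _ := rfl

/-- The right action of the isometries on points; `F <• a` is then the image of the set `F`. -/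
noncomputable instance (d : ℕ) : MulAction (EucGroup d)ᵐᵒᵖ (E d) where
  smul a x := (MulOpposite.unop (MulOpposite.unop a)) x
  one_smul _ := rfl
  mul_smul _ _ _ := rfl

/-- The right action of the similarities on points; `F <• a` is then the image of the set `F`. -/
noncomputable instance (d : ℕ) : MulAction (SimGroup d)ᵐᵒᵖ (E d) where
  smul a x := (MulOpposite.unop (MulOpposite.unop a)) x
  one_smul _ := rfl
  mul_smul _ _ _ := rfl

/-- The symmetry group `G(F)` of a figure: the isometries `a` with `F a = F`. -/
noncomputable def symGroup {d : ℕ} (F : Set (E d)) : Subgroup (EucGroup d) where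
  carrier := {a | F <• a = F}
  one_mem' := by simp
  mul_mem' {a b} ha hb := by
    change F <• a = F at ha
    change F <• b = F at hb
    change F <• (a * b) = F
    rw [MulOpposite.op_mul, mul_smul, ha, hb]
  inv_mem' {a} ha := by
    change F <• a = F at ha
    change F <• a⁻¹ = F
    rw [MulOpposite.op_inv, inv_smul_eq_iff, ha]

/-- The set `cc(F)` of the connected components of a figure. -/
def components {d : ℕ} (F : Set (E d)) : Set (Set (E d)) :=
  {K | ∃ x ∈ F, K = connectedComponentIn F x}

theorem components_nonempty {d : ℕ} {F : Set (E d)} (hF : F.Nonempty) : (components F).Nonempty :=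
  hF.elim fun x hx => ⟨connectedComponentIn F x, x, hx, rfl⟩

/-- The similarity symmetry partial group `Sim𝒫(F)` of a nonempty figure: the partial group of the
parades in the set of the connected components of `F` under the group of similarities. -/
noncomputable def simPartialGroup {d : ℕ} (F : Set (E d)) (hF : F.Nonempty) : PartialGroup.{0} :=
  parade (SimGroup d) (components F) (components_nonempty hF)

/-- Two figures are congruent if an isometry of `ℝᵈ` takes one to the other. -/
def Congruent {d : ℕ} (K L : Set (E d)) : Prop := ∃ a : EucGroup d, K <• a = L

/-- The partial group `G(K)`. -/
noncomputable abbrev symPartialGroup {d : ℕ} (K : Set (E d)) : PartialGroup.{0} := ofGroup (symGroup K)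

/-- The inclusion of `G(K) ∩ G(L)` in `G(K)`, as a map of partial groups. -/
noncomputable def interLeft {d : ℕ} (K L : Set (E d)) :
    ofGroup ↥(symGroup K ⊓ symGroup L) ⟶ symPartialGroup K :=
  ofGroupHom (Subgroup.inclusion inf_le_left)

/-- The inclusion of `G(K) ∩ G(L)` in `G(L)`, as a map of partial groups. -/
noncomputable def interRight {d : ℕ} (K L : Set (E d)) :
    ofGroup ↥(symGroup K ⊓ symGroup L) ⟶ symPartialGroup L :=
  ofGroupHom (Subgroup.inclusion inf_le_right)

/-- Let `H` be a partial group with maps `jᵢ : G(Kᵢ) → H`, `i = 0, 1`, and let `γ` be a similarity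
with `K₀ γ = K₁`. This says that a `𝒱({0,1})`-partial group structure on `H` is the one by
conjugation by powers of `γ`, that is,
`Hᵣ 𝒱({0,1})ₙ = {((j (a₁), …, j (aᵣ)) | ι₁ - ι₀, …, ιₙ - ιₙ₋₁) | a₁, …, aᵣ ∈ G(K_ι₀)}`,
where `ι₀, …, ιₙ` run through `{0, 1}`, and the action map sends this element to the word of all
`j (γ^(ι₀ - ιₙ) aₖ γ^(ιₙ - ι₀))`, where the arguments of `j` are in `G(K_ιₙ)`. -/
structure IsConjAction {d : ℕ} {K : Fin 2 → Set (E d)} {H : PartialGroup.{0}}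
    (j : ∀ i, symPartialGroup (K i) ⟶ H) (γ : SimGroup d) (S : PGAction V01 H) : Prop where
  dom_iff : ∀ (η : H.Word) (δ : List V01.carrier), S.dom η δ ↔
    ∃ ι₀ : Fin 2, IsRoute ({0, 1} : Set ℤ) ((ι₀ : ℕ) : ℤ) (δ.map Subtype.val) ∧
      ∃ a : List (symGroup (K ι₀)), η.1 = a.map (j ι₀).toFun
  act_eq : ∀ (η : H.Word) (δ : List V01.carrier) (h : S.dom η δ) (ι₀ ιₙ : Fin 2),
    IsRoute ({0, 1} : Set ℤ) ((ι₀ : ℕ) : ℤ) (δ.map Subtype.val) →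
    (((ι₀ : ℕ) : ℤ) <• (δ.map Subtype.val).prod) = ((ιₙ : ℕ) : ℤ) →
    ∀ a : List (symGroup (K ι₀)), η.1 = a.map (j ι₀).toFun →
    ∃ b : List (symGroup (K ιₙ)), (S.act η δ h).1 = b.map (j ιₙ).toFun ∧
      List.Forall₂ (fun x y => eucToSim d (y : EucGroup d) =
        γ ^ (((ι₀ : ℕ) : ℤ) - ((ιₙ : ℕ) : ℤ)) * eucToSim d (x : EucGroup d) *
          γ ^ (((ιₙ : ℕ) : ℤ) - ((ι₀ : ℕ) : ℤ))) a b

end Figure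

/-! ### Recognizing isomorphisms of partial groups. -/

namespace PartialGroup

/-! Both symmetry groups are subgroups of the isometry group. The pushout of two subgroups over
their intersection, in the category of partial groups, is merely their union: a word is multipliable
when all its letters lie in one of the two subgroups. Nothing has to be amalgamated, because a
multipliable word lives in a single group, so two maps that agree on the intersection glue, and in
only one way (`isPushout_union`).

Hence any pushout `H` embeds in the similarity group `N` as the union of the groups `A 0` and `A 1`,
where `A z` is the stabilizer of `K 0 <• γ ^ z` in the normal subgroup `L` of isometries
(`exists_conjModel`). Conjugation by `γ ^ n` carries `A z` into `A (z + n)`, and this partially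
defined conjugation is the action on `H`. All axioms of the action reduce to facts about conjugation
in `N`, since a word together with a route of steps has one base point `z` that serves all its
letters.

An element `δ ⋉ η` of the semidirect product is realized as `γ ^ δ * η` in `N`. A word is
multipliable in the semidirect product exactly when its realizations form a parade in the
components: the letters of the word `A (α)` stabilize the component where the parade ends, and the
inverse word of steps is the route traced backwards from there. The product telescopes to a power of
`γ` times the product of `A (α)` (`prod_map_realize`, `isRoute_map_realize`, `exists_spine`).

Two metric facts make the realization bijective and the multipliable words correspond. No nonzero
power of `γ` is an isometry, as its ratio differs from 1 when the components are not congruent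
(`eq_zero_of_zpow_mem`). And a similarity between components is the matching power of `γ` times an
isometry, because both scale a positive finite diameter by the same factor (`inv_zpow_mul_mem`).
These enter `nonempty_iso_parade` as its hypotheses `hL` and `hX`. -/

@[ext]
theorem hom_ext {P Q : PartialGroup.{u}} {f g : P ⟶ Q} (h : ∀ x, f.toFun x = g.toFun x) : f = g :=
  Hom.ext (funext h)

/-- A bijective map of partial groups that reflects multipliability of words is an isomorphism. -/
theorem nonempty_iso_of_bijective {P Q : PartialGroup.{u}} (f : P ⟶ Q)
    (hf : Function.Bijective f.toFun) (hdom : ∀ w, w.map f.toFun ∈ Q.dom → w ∈ P.dom) :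
    Nonempty (P ≅ Q) := by
  obtain ⟨g, hl, hr⟩ := Function.bijective_iff_has_inverse.1 hf
  have hm : ∀ w : List Q.carrier, (w.map g).map f.toFun = w := fun w => by
    rw [List.map_map, hr.comp_eq_id, List.map_id]
  have hg : ∀ w ∈ Q.dom, w.map g ∈ P.dom := fun w hw => hdom _ (by rwa [hm])
  let g' : Q ⟶ P :=
    { toFun := g
      map_mem := hg
      map_prod := fun w h => by
        apply hf.1
        rw [← f.map_prod _ (hg w h), hr]
        exact Q.prod_congr (hm w) _ _ }
  exact ⟨⟨f, g', hom_ext hl, hom_ext hr⟩⟩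

/-! ### Unions of subgroups -/

section Union

variable {G : Type u} [Group G] {ι : Type v} [Nonempty ι]

/-- The union of a family of subgroups as a partial group: a word can be multiplied if all its
letters belong to the same member of the family. -/
def unionOfSubgroups (A : ι → Subgroup G) : PartialGroup.{u} where
  carrier := {g : G // ∃ i, g ∈ A i}
  dom := {w | w ≠ [] ∧ ∃ i, ∀ g ∈ w, g.1 ∈ A i}
  prod w h := ⟨(w.map Subtype.val).prod, h.2.imp fun i hi =>
    Subgroup.list_prod_mem _ (by simpa using fun g hg h' => hi ⟨g, hg⟩ h')⟩
  nil_notMem := by simp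
  singleton_mem g := ⟨by simp, by simpa using g.2⟩
  prod_singleton := by simp
  tail_mem x w h hw := ⟨hw, h.2.imp fun i hi g hg => hi g (by simp [hg])⟩
  dropLast_mem w x h hw := ⟨hw, h.2.imp fun i hi g hg => hi g (by simp [hg])⟩
  assoc u v w hv h := by
    refine ⟨⟨by simp, h.2.imp fun i hi g hg => ?_⟩, by simp⟩
    simp only [List.mem_append, List.mem_singleton] at hg hi
    rcases hg with (hg | rfl) | hg
    · exact hi g (by simp [hg])
    · refine Subgroup.list_prod_mem _ fun y hy => ?_
      obtain ⟨g, hg, rfl⟩ := List.mem_map.1 hy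
      exact hi g (by simp [hg])
    · exact hi g (by simp [hg])
  one := ⟨1, Classical.arbitrary ι, one_mem _⟩
  insert_one_mem u v h := by
    refine ⟨by simp, h.2.imp fun i hi g hg => ?_⟩
    simp only [List.mem_append, List.mem_singleton] at hg hi
    rcases hg with (hg | rfl) | hg
    · exact hi g (by simp [hg])
    · exact one_mem _
    · exact hi g (by simp [hg])
  one_prod := by simp
  prod_one := by simp
  inv g := ⟨g.1⁻¹, g.2.imp fun _ => inv_mem⟩
  append_inv_mem w h := by
    refine ⟨by simp [h.1], h.2.imp fun i hi g hg => ?_⟩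
    simp only [List.mem_append, List.mem_reverse, List.mem_map] at hg
    rcases hg with hg | ⟨g, hg, rfl⟩
    · exact hi g hg
    · exact inv_mem (hi g hg)
  inv_append_mem w h := by
    refine ⟨by simp [h.1], h.2.imp fun i hi g hg => ?_⟩
    simp only [List.mem_append, List.mem_reverse, List.mem_map] at hg
    rcases hg with ⟨g, hg, rfl⟩ | hg
    · exact inv_mem (hi g hg)
    · exact hi g hg
  prod_inv := by simp
  inv_prod := by simp

/-- The inclusion of a member of the family in the union. -/
def toUnion (A : ι → Subgroup G) (i : ι) : ofGroup (A i) ⟶ unionOfSubgroups A where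
  toFun g := ⟨g.1, i, g.2⟩
  map_mem w h := by
    refine ⟨fun e => h (List.map_eq_nil_iff.1 e), i, fun g hg => ?_⟩
    obtain ⟨x, -, rfl⟩ := List.mem_map.1 hg
    exact x.2
  map_prod (w : List (A i)) _ := by
    apply Subtype.ext
    have h : (w.map Subtype.val).prod = w.prod.1 := (map_list_prod (A i).subtype w).symm
    exact (congrArg List.prod (List.map_map (l := w))).trans h

/-- Reduces statements about multipliable words of the union to words in a single group, where the
given maps are already homomorphisms. -/
theorem exists_map_toUnion (A : ι → Subgroup G) {w : List (unionOfSubgroups A).carrier}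
    (hw : w ∈ (unionOfSubgroups A).dom) :
    ∃ i, ∃ a : List (ofGroup (A i)).carrier, w = a.map (toUnion A i).toFun := by
  obtain ⟨-, i, hi⟩ := hw
  refine ⟨i, w.attach.map fun g => (⟨g.1.1, hi g.1 g.2⟩ : A i), ?_⟩
  refine Eq.trans ?_ (List.map_map (l := w.attach)).symm
  exact w.attach_map_subtype_val.symm

/-- Compatible maps on all members of a family of subgroups glue to a map on the union. -/
theorem exists_hom_union (A : ι → Subgroup G) {P : PartialGroup.{u}} (f : ∀ i, ofGroup (A i) ⟶ P)
    (hf : ∀ i k g (hi : g ∈ A i) (hk : g ∈ A k), (f i).toFun ⟨g, hi⟩ = (f k).toFun ⟨g, hk⟩) :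
    ∃ F : unionOfSubgroups A ⟶ P, ∀ i, toUnion A i ≫ F = f i := by
  -- The member of the family containing `g` is chosen arbitrarily; by `hf` the value does not
  -- depend on the choice.
  let F₀ : (unionOfSubgroups A).carrier → P.carrier :=
    fun g => (f g.2.choose).toFun ⟨g.1, g.2.choose_spec⟩
  have hF : ∀ i (w : List (ofGroup (A i)).carrier),
      (w.map (toUnion A i).toFun).map F₀ = w.map (f i).toFun := fun i w =>
    List.map_map.trans (List.map_congr_left fun g _ => hf _ _ _ _ _)
  have hlift : ∀ w ∈ (unionOfSubgroups A).dom,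
      ∃ i, ∃ a ∈ (ofGroup (A i)).dom, w = a.map (toUnion A i).toFun := fun w hw => by
    obtain ⟨i, a, rfl⟩ := exists_map_toUnion A hw
    exact ⟨i, a, fun e => hw.1 (List.map_eq_nil_iff.2 e), rfl⟩
  refine ⟨⟨F₀, ?_, ?_⟩, fun i => hom_ext fun g => hf _ _ _ _ _⟩
  · intro w hw
    obtain ⟨i, a, ha, rfl⟩ := hlift w hw
    rw [hF]
    exact (f i).map_mem a ha
  · intro w hw
    obtain ⟨i, a, ha, rfl⟩ := hlift w hw
    rw [(toUnion A i).map_prod a ha]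
    refine (P.prod_congr (hF i a) _ ((f i).map_mem a ha)).trans (((f i).map_prod a ha).trans ?_)
    exact hf _ _ _ _ _

/-- The union of two subgroups of a group is their pushout over the intersection. -/
theorem isPushout_union (A : Fin 2 → Subgroup G) :
    IsPushout (ofGroupHom (Subgroup.inclusion (inf_le_right : A 0 ⊓ A 1 ≤ A 1)))
      (ofGroupHom (Subgroup.inclusion (inf_le_left : A 0 ⊓ A 1 ≤ A 0)))
      (toUnion A 1) (toUnion A 0) := by
  have key : ∀ {P : PartialGroup.{u}} (f₁ : ofGroup (A 1) ⟶ P) (f₀ : ofGroup (A 0) ⟶ P),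
      ofGroupHom (Subgroup.inclusion (inf_le_right : A 0 ⊓ A 1 ≤ A 1)) ≫ f₁ =
        ofGroupHom (Subgroup.inclusion (inf_le_left : A 0 ⊓ A 1 ≤ A 0)) ≫ f₀ →
      ∃ F : unionOfSubgroups A ⟶ P, toUnion A 1 ≫ F = f₁ ∧ toUnion A 0 ≫ F = f₀ := by
    intro P f₁ f₀ e
    -- The commutativity of the square, evaluated at an element of the intersection, is the
    -- compatibility that gluing needs.
    have e' : ∀ g (h0 : g ∈ A 0) (h1 : g ∈ A 1), f₁.toFun ⟨g, h1⟩ = f₀.toFun ⟨g, h0⟩ :=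
      fun g h0 h1 => by
        let x : ↥(A 0 ⊓ A 1) := ⟨g, h0, h1⟩
        exact congrArg (fun k => Hom.toFun k x) e
    obtain ⟨F, hF⟩ := exists_hom_union A (P := P)
      (fun i => match i with | 0 => f₀ | 1 => f₁) (by
        intro i k g hi hk
        match i, k with
        | 0, 0 => rfl
        | 0, 1 => exact (e' g hi hk).symm
        | 1, 0 => exact e' g hk hi
        | 1, 1 => rfl)
    exact ⟨F, hF 1, hF 0⟩
  refine ⟨⟨rfl⟩, ⟨Limits.PushoutCocone.IsColimit.mk _
    (fun s => (key s.inl s.inr s.condition).choose)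
    (fun s => (key s.inl s.inr s.condition).choose_spec.1)
    (fun s => (key s.inl s.inr s.condition).choose_spec.2)
    fun s m h1 h0 => ?_⟩⟩
  -- Uniqueness: each element of the union comes from one of the two subgroups, where both maps are
  -- prescribed.
  obtain ⟨k1, k0⟩ := (key s.inl s.inr s.condition).choose_spec
  refine hom_ext fun ⟨g, i, hi⟩ => ?_
  match i with
  | 0 => exact congrArg (fun k => Hom.toFun k (⟨g, hi⟩ : A 0)) (h0.trans k0.symm)
  | 1 => exact congrArg (fun k => Hom.toFun k (⟨g, hi⟩ : A 1)) (h1.trans k1.symm)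

end Union

end PartialGroup

namespace PartialGroup

/-! ### Words of steps between points of a set of integers -/

section Steps

variable {Z : Set ℤ} {hZ : Z.Nonempty}

/-- The word of integers underlying a word of vector parades. -/
def steps (δ : List (vectorParades Z hZ).carrier) : List (Multiplicative ℤ) := δ.map Subtype.val

theorem steps_append (u v : List (vectorParades Z hZ).carrier) :
    steps (u ++ v) = steps u ++ steps v := List.map_append

theorem steps_cons (x : (vectorParades Z hZ).carrier) (v : List (vectorParades Z hZ).carrier) :
    steps (x :: v) = x.1 :: steps v := rfl

theorem steps_invWord (u : List (vectorParades Z hZ).carrier) :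
    steps ((vectorParades Z hZ).invWord u) = ((steps u).map (·⁻¹)).reverse := by
  refine List.map_reverse.trans (congrArg List.reverse ?_)
  exact Eq.trans List.map_map (List.map_map (l := u) (f := Subtype.val) (g := (·⁻¹))).symm

theorem mem_dom_vectorParades {w : List (vectorParades Z hZ).carrier} :
    w ∈ (vectorParades Z hZ).dom ↔ w ≠ [] ∧ ∃ z, IsRoute Z z (steps w) := Iff.rfl

theorem IsRoute.add_mem {z : ℤ} {w : List (Multiplicative ℤ)} (h : IsRoute Z z w) :
    z + w.prod.toAdd ∈ Z := h.finish

theorem IsRoute.append_inv {z : ℤ} {w : List (Multiplicative ℤ)}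
    (h : IsRoute Z z w) : IsRoute Z z (w ++ (w.map (·⁻¹)).reverse) :=
  isRoute_append.2 ⟨h, h.inv⟩

end Steps

/-- A realization of the partial group `H` as the union of the subgroups `A z`, `z ∈ Z`, of a group
`N`, where `A (z + n)` contains the conjugate of `A z` by `γ ^ n`. -/
structure ConjModel (H : PartialGroup.{u}) {N : Type u} [Group N] (A : ℤ → Subgroup N)
    (Z : Set ℤ) (γ : N) where
  val : H.carrier → N
  val_injective : Function.Injective val
  mem_dom : ∀ w, w ∈ H.dom ↔ w ≠ [] ∧ ∃ z ∈ Z, ∀ x ∈ w, val x ∈ A z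
  exists_val : ∀ z ∈ Z, ∀ g ∈ A z, ∃ x, val x = g
  val_prod : ∀ w h, val (H.prod w h) = (w.map val).prod
  conj_mem : ∀ z (n : ℤ), ∀ g ∈ A z, (γ ^ n)⁻¹ * g * γ ^ n ∈ A (z + n)

/-! ### Partially defined conjugation by powers of `γ`. -/

namespace ConjModel

variable {N : Type u} [Group N] {H : PartialGroup.{u}} {A : ℤ → Subgroup N} {Z : Set ℤ} {γ : N}
  (M : ConjModel H A Z γ)
include M

theorem val_one : M.val H.one = 1 := by
  have h : [H.one, H.one] ∈ H.dom := H.insert_one_mem [] [H.one] (H.singleton_mem _)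
  have := M.val_prod _ h
  rw [H.one_prod] at this
  simpa using this

theorem val_inv (x : H.carrier) : M.val (H.inv x) = (M.val x)⁻¹ := by
  have := M.val_prod _ (H.mem_pair_inv x)
  rw [H.prod_inv, M.val_one] at this
  exact (inv_eq_of_mul_eq_one_right (by simpa using this.symm)).symm

open Classical in
/-- Conjugation by `γ ^ n`, where it is defined. -/
noncomputable def shift (n : Multiplicative ℤ) (x : H.carrier) : H.carrier :=
  if h : ∃ y, M.val y = (γ ^ n.toAdd)⁻¹ * M.val x * γ ^ n.toAdd then h.choose else x

/-- The condition for `(ξ | δ)` to be in the domain of the action. -/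
def ActDom (ξ : List H.carrier) (δ : List (Multiplicative ℤ)) : Prop :=
  ∃ z, IsRoute Z z δ ∧ ∀ x ∈ ξ, M.val x ∈ A z

variable {M}

/-- Since `z + n` is again in `Z`, the conjugate lies in a subgroup covered by `val`, so the default
branch of `shift` is not taken. The value itself does not involve `z`, so different base points for
the same element agree. -/
theorem val_shift {z : ℤ} {n : Multiplicative ℤ} {x : H.carrier} (hx : M.val x ∈ A z)
    (hz : z + n.toAdd ∈ Z) : M.val (M.shift n x) = (γ ^ n.toAdd)⁻¹ * M.val x * γ ^ n.toAdd := by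
  have h : ∃ y, M.val y = (γ ^ n.toAdd)⁻¹ * M.val x * γ ^ n.toAdd :=
    M.exists_val _ hz _ (M.conj_mem _ _ _ hx)
  rw [shift, dif_pos h]
  exact h.choose_spec

theorem val_shift_mem {z : ℤ} {n : Multiplicative ℤ} {x : H.carrier} (hx : M.val x ∈ A z)
    (hz : z + n.toAdd ∈ Z) : M.val (M.shift n x) ∈ A (z + n.toAdd) := by
  rw [val_shift hx hz]
  exact M.conj_mem _ _ _ hx

theorem map_shift_mem {z : ℤ} {n : Multiplicative ℤ} {ξ : List H.carrier}
    (hξ : ∀ x ∈ ξ, M.val x ∈ A z) (hz : z + n.toAdd ∈ Z) :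
    ∀ y ∈ ξ.map (M.shift n), M.val y ∈ A (z + n.toAdd) := by
  intro y hy
  obtain ⟨x, hx, rfl⟩ := List.mem_map.1 hy
  exact val_shift_mem (hξ x hx) hz

theorem ActDom.map_shift_mem_dom {ξ : List H.carrier} {δ : List (Multiplicative ℤ)}
    (h : M.ActDom ξ δ) (hξ : ξ ≠ []) : ξ.map (M.shift δ.prod) ∈ H.dom := by
  obtain ⟨z, hz, hx⟩ := h
  exact (M.mem_dom _).2 ⟨by simpa using hξ, _, hz.add_mem, map_shift_mem hx hz.add_mem⟩

/-- Serves the closure axioms in which the base point of the route does not change. -/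
theorem ActDom.mono {ξ ζ : List H.carrier} {δ ε : List (Multiplicative ℤ)} (h : M.ActDom ξ δ)
    (hε : ∀ z, IsRoute Z z δ → IsRoute Z z ε)
    (hζ : ∀ z, (∀ x ∈ ξ, M.val x ∈ A z) → ∀ x ∈ ζ, M.val x ∈ A z) : M.ActDom ζ ε :=
  h.imp fun z hz => ⟨hε z hz.1, hζ z hz.2⟩

/-- No base point is assumed: a one-letter word is always multipliable, and this supplies some `z`
for `x`. -/
theorem shift_one (x : H.carrier) : M.shift 1 x = x := by
  obtain ⟨-, z, hz, hx⟩ := (M.mem_dom _).1 (H.singleton_mem x)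
  apply M.val_injective
  rw [val_shift (hx x (by simp)) (by simpa using hz)]
  simp

/-- The intermediate point must be in `Z` as well, as otherwise the inner conjugate need not belong
to `H`. -/
theorem shift_shift {z : ℤ} {n m : Multiplicative ℤ} {x : H.carrier} (hx : M.val x ∈ A z)
    (hz : z + n.toAdd ∈ Z) (hz' : z + n.toAdd + m.toAdd ∈ Z) :
    M.shift m (M.shift n x) = M.shift (n * m) x := by
  apply M.val_injective
  rw [val_shift (val_shift_mem hx hz) hz', val_shift hx hz,
    val_shift hx (by simpa [add_assoc] using hz'), toAdd_mul, zpow_add]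
  group

/-- Conjugation is an automorphism of `N`, and all letters of `w`, hence also their product, share
the base point `z`. -/
theorem shift_prod {z : ℤ} {n : Multiplicative ℤ} {w : List H.carrier} (hw : w ∈ H.dom)
    (hx : ∀ x ∈ w, M.val x ∈ A z) (hz : z + n.toAdd ∈ Z) (h : w.map (M.shift n) ∈ H.dom) :
    M.shift n (H.prod w hw) = H.prod (w.map (M.shift n)) h := by
  apply M.val_injective
  have hp : M.val (H.prod w hw) ∈ A z := by
    rw [M.val_prod]
    exact Subgroup.list_prod_mem _ fun y hy => by
      obtain ⟨x, hx', rfl⟩ := List.mem_map.1 hy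
      exact hx x hx'
  rw [val_shift hp hz, M.val_prod, M.val_prod]
  have e : (w.map (M.shift n)).map M.val =
      (w.map M.val).map (MulAut.conj (γ ^ n.toAdd)⁻¹) := by
    rw [List.map_map, List.map_map]
    refine List.map_congr_left fun x hx' => ?_
    simp only [Function.comp_apply, val_shift (hx x hx') hz, MulAut.conj_apply,
      _root_.inv_inv]
  rw [e, ← map_list_prod, MulAut.conj_apply, _root_.inv_inv]

theorem shift_one_right {z : ℤ} {n : Multiplicative ℤ} (hz : z + n.toAdd ∈ Z) :
    M.shift n H.one = H.one := by
  apply M.val_injective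
  rw [val_shift (z := z) (by rw [M.val_one]; exact one_mem _) hz, M.val_one]
  group

theorem shift_inv {z : ℤ} {n : Multiplicative ℤ} {x : H.carrier} (hx : M.val x ∈ A z)
    (hz : z + n.toAdd ∈ Z) : M.shift n (H.inv x) = H.inv (M.shift n x) := by
  apply M.val_injective
  rw [val_shift (z := z) (by rw [M.val_inv]; exact inv_mem hx) hz, M.val_inv, M.val_inv,
    val_shift hx hz]
  group

theorem map_shift_invWord {z : ℤ} {n : Multiplicative ℤ} {w : List H.carrier}
    (hx : ∀ x ∈ w, M.val x ∈ A z) (hz : z + n.toAdd ∈ Z) :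
    (H.invWord w).map (M.shift n) = H.invWord (w.map (M.shift n)) := by
  rw [invWord, invWord, List.map_reverse, List.map_map, List.map_map]
  congr 1
  exact List.map_congr_left fun x hx' => shift_inv (hx x hx') hz

theorem val_invWord_mem {z : ℤ} {w : List H.carrier} (hx : ∀ x ∈ w, M.val x ∈ A z) :
    ∀ x ∈ H.invWord w, M.val x ∈ A z := by
  intro y hy
  simp only [invWord, List.mem_reverse, List.mem_map] at hy
  obtain ⟨x, hx', rfl⟩ := hy
  rw [M.val_inv]
  exact inv_mem (hx x hx')

theorem val_mem_of_append {z : ℤ} {u v : List H.carrier} (hu : ∀ x ∈ u, M.val x ∈ A z)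
    (hv : ∀ x ∈ v, M.val x ∈ A z) : ∀ x ∈ u ++ v, M.val x ∈ A z := by
  intro x hx
  exact (List.mem_append.1 hx).elim (hu x) (hv x)

end ConjModel

/-! ### The action of the vector parades on `H`. -/

namespace ConjModel

variable {N : Type} [Group N] {H : PartialGroup.{0}} {A : ℤ → Subgroup N} {Z : Set ℤ} {γ : N}
  (M : ConjModel H A Z γ) (hZ : Z.Nonempty)

/-- The action of the vector parades on the words of `H` by conjugation by powers of `γ`. -/
noncomputable def pset : PSet (vectorParades Z hZ) H.Word where
  dom η δ := M.ActDom η.1 (steps δ)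
  act η δ h := ⟨η.1.map (M.shift (steps δ).prod), h.map_shift_mem_dom (H.ne_nil_of_mem η.2)⟩
  dom_mem η δ h hδ := mem_dom_vectorParades.2 ⟨hδ, h.imp fun _ => And.left⟩
  dom_nil η := by
    obtain ⟨-, z, hz, hx⟩ := (M.mem_dom _).1 η.2
    exact ⟨z, hz, hx⟩
  act_nil η := Subtype.ext <| by
    change η.1.map (M.shift 1) = η.1
    exact (List.map_congr_left fun x _ => shift_one x).trans (List.map_id _)
  dropLast_dom η δ g h := h.mono (fun z hz => by
    rw [steps_append, isRoute_append] at hz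
    exact hz.1) fun _ => id
  act_act η u v hu h := by
    obtain ⟨z, hz, hx⟩ := h
    rw [steps_append, isRoute_append] at hz
    -- After `u` has acted, the base point moves to the end of the route `u`, where the conjugated
    -- letters now live.
    refine ⟨⟨_, hz.2, map_shift_mem hx hz.1.add_mem⟩, Subtype.ext ?_⟩
    refine List.map_map.trans (List.map_congr_left fun x hx' => ?_)
    rw [steps_append, List.prod_append]
    exact shift_shift (hx x hx') hz.1.add_mem hz.2.add_mem
  act_assoc η u v w hv h := by
    have e : (steps (u ++ [(vectorParades Z hZ).prod v hv] ++ w)).prod =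
        (steps (u ++ v ++ w)).prod := by
      simp only [steps_append, List.prod_append]
      congr 2
      -- The merged letter is by definition the product of the block, so the one-letter product is
      -- that times 1.
      exact mul_one _
    refine ⟨h.mono (fun z hz => ?_) fun _ => id, Subtype.ext ?_⟩
    · simp only [steps_append, isRoute_append, List.prod_append] at hz ⊢
      refine ⟨⟨hz.1.1, hz.1.2.prod_single⟩, ?_⟩
      have := hz.2
      convert this using 4
      exact mul_one _
    · change η.1.map _ = η.1.map _
      rw [e]
  insert_one_dom η u v h := h.mono (fun z hz => by
    simp only [steps_append, isRoute_append, List.prod_append] at hz ⊢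
    have e : (steps [(vectorParades Z hZ).one]).prod = 1 := mul_one _
    refine ⟨⟨hz.1, hz.2.start, ?_⟩, ?_⟩
    · change (z <• _) <• (1 : Multiplicative ℤ) ∈ Z
      rw [MulOpposite.op_one, one_smul]
      exact hz.2.start
    · rw [e, mul_one]
      exact hz.2) fun _ => id
  act_one η h := Subtype.ext <| by
    change η.1.map (M.shift (1 * 1)) = η.1
    rw [mul_one]
    exact (List.map_congr_left fun x _ => shift_one x).trans (List.map_id _)
  append_inv_dom η δ h := h.mono (fun z hz => by
    rw [steps_append, steps_invWord]
    exact hz.append_inv) fun _ => id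

/-- The partial group structure on `H` over the vector parades by conjugation by powers
of `γ`. -/
noncomputable def pgAction : PGAction (vectorParades Z hZ) H where
  toPSet := M.pset hZ
  length_act η δ h := List.length_map _
  tail_equivariant η ζ e δ h := ⟨h.mono (fun _ => id) fun z hz x hx =>
    hz x (List.mem_of_mem_tail (e ▸ hx)), (congrArg (List.map _) e).trans List.map_tail⟩
  dropLast_equivariant η ζ e δ h := ⟨h.mono (fun _ => id) fun z hz x hx =>
    hz x (List.mem_of_mem_dropLast (e ▸ hx)), (congrArg (List.map _) e).trans List.map_dropLast⟩
  merge_equivariant p q η ζ e δ h := by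
    obtain ⟨u, v, w, hv, hu, hq, e1, e2⟩ := e
    obtain ⟨z, hz, hx⟩ := id h
    rw [e1] at hx
    have hxu : ∀ x ∈ u, M.val x ∈ A z := fun x h => hx x (by simp [h])
    have hxv : ∀ x ∈ v, M.val x ∈ A z := fun x h => hx x (by simp [h])
    have hxw : ∀ x ∈ w, M.val x ∈ A z := fun x h => hx x (by simp [h])
    -- The conjugated block stays multipliable because its letters move together from `A z` to the
    -- subgroup at the end of the route.
    have hv' : v.map (M.shift (steps δ).prod) ∈ H.dom :=
      ActDom.map_shift_mem_dom ⟨z, hz, hxv⟩ (H.ne_nil_of_mem hv)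
    refine ⟨⟨z, hz, ?_⟩, u.map (M.shift (steps δ).prod), v.map (M.shift (steps δ).prod),
      w.map (M.shift (steps δ).prod), hv', ?_, ?_, ?_, ?_⟩
    · rw [e2]
      refine val_mem_of_append (val_mem_of_append hxu ?_) hxw
      intro x hx
      rw [List.mem_singleton.1 hx, M.val_prod]
      exact Subgroup.list_prod_mem _ fun y hy => by
        obtain ⟨x, hx', rfl⟩ := List.mem_map.1 hy
        exact hxv x hx'
    · simpa using hu
    · simpa using hq
    · change η.1.map _ = _
      rw [e1, List.map_append, List.map_append]
    · change ζ.1.map _ = _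
      rw [e2, List.map_append, List.map_append, ← shift_prod hv hxv hz.add_mem hv',
        List.map_singleton]
  insert_one_equivariant i η ζ e δ h := by
    obtain ⟨u, v, hu, e1, e2⟩ := e
    obtain ⟨z, hz, hx⟩ := id h
    rw [e1] at hx
    refine ⟨⟨z, hz, ?_⟩, u.map (M.shift (steps δ).prod), v.map (M.shift (steps δ).prod), ?_, ?_, ?_⟩
    · rw [e2]
      refine val_mem_of_append (val_mem_of_append (fun x h => hx x (by simp [h])) ?_)
        (fun x h => hx x (by simp [h]))
      intro x hx
      rw [List.mem_singleton.1 hx, M.val_one]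
      exact one_mem _
    · simpa using hu
    · change η.1.map _ = _
      rw [e1, List.map_append]
    · change ζ.1.map _ = _
      rw [e2, List.map_append, List.map_append, List.map_singleton, shift_one_right hz.add_mem]
  dom_one w hw := by
    obtain ⟨-, z, hz⟩ := mem_dom_vectorParades.1 hw
    refine ⟨z, hz, fun x hx => ?_⟩
    rw [List.mem_singleton.1 hx, M.val_one]
    exact one_mem _
  act_one_left w h := by
    obtain ⟨z, hz, -⟩ := id h
    exact Subtype.ext (congrArg (fun x => [x]) (shift_one_right hz.add_mem))
  append_inv_equivariant η ζ e δ h := by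
    obtain ⟨z, hz, hx⟩ := id h
    refine ⟨⟨z, hz, ?_⟩, ?_⟩
    · rw [e]
      exact val_mem_of_append hx (val_invWord_mem hx)
    · change ζ.1.map _ = _
      rw [e, List.map_append, map_shift_invWord hx hz.add_mem]
      rfl
  inv_append_equivariant η ζ e δ h := by
    obtain ⟨z, hz, hx⟩ := id h
    refine ⟨⟨z, hz, ?_⟩, ?_⟩
    · rw [e]
      exact val_mem_of_append (val_invWord_mem hx) hx
    · change ζ.1.map _ = _
      rw [e, List.map_append, map_shift_invWord hx hz.add_mem]
      rfl

end ConjModel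

end PartialGroup

/-! ### Stabilizers along an orbit of `γ`. -/

namespace PartialGroup

section Stabilizer

variable {N : Type u} [Group N] {X₀ : Type v} [MulAction Nᵐᵒᵖ X₀]

/-- The elements of a subgroup `L` that fix the point `x` under a right action. -/
def rightStabilizer (L : Subgroup N) (x : X₀) : Subgroup N where
  carrier := {g | g ∈ L ∧ x <• g = x}
  one_mem' := ⟨one_mem _, by simp⟩
  mul_mem' {a b} ha hb := ⟨mul_mem ha.1 hb.1, by rw [MulOpposite.op_mul, mul_smul, ha.2, hb.2]⟩
  inv_mem' {a} ha := ⟨inv_mem ha.1, by rw [MulOpposite.op_inv, inv_smul_eq_iff, ha.2]⟩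

theorem smul_zpow_zpow (k : X₀) (γ : N) (z n : ℤ) : (k <• γ ^ z) <• γ ^ n = k <• γ ^ (z + n) := by
  rw [smul_smul, ← MulOpposite.op_mul, ← zpow_add]

/-- Normality keeps the conjugate in `L`; moving back by `γ ^ n`, applying `g` and moving forward
again fixes the shifted point. This provides the field `conj_mem` for figures. -/
theorem conj_mem_rightStabilizer {L : Subgroup N} [L.Normal] {k : X₀} {γ : N} (z n : ℤ) {g : N}
    (hg : g ∈ rightStabilizer L (k <• γ ^ z)) :
    (γ ^ n)⁻¹ * g * γ ^ n ∈ rightStabilizer L (k <• γ ^ (z + n)) := by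
  constructor
  · simpa using Subgroup.Normal.conj_mem ‹L.Normal› g hg.1 (γ ^ n)⁻¹
  · have e : (k <• γ ^ (z + n)) <• (γ ^ n)⁻¹ = k <• γ ^ z := by
      rw [← zpow_neg, smul_zpow_zpow, add_neg_cancel_right]
    rw [MulOpposite.op_mul, MulOpposite.op_mul, mul_smul, mul_smul, e, hg.2, smul_zpow_zpow]

end Stabilizer

/-! ### The semidirect product realized by parades. -/

namespace ConjModel

variable {N : Type} [Group N] {H : PartialGroup.{0}} {Z : Set ℤ} {γ : N}

section

variable {A : ℤ → Subgroup N} {M : ConjModel H A Z γ} {hZ : Z.Nonempty}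

/-- Makes the relational description of multipliability explicit, so that spines can be computed in
`N`. -/
theorem act_iff {ξ ζ : List H.carrier} {δ : List (vectorParades Z hZ).carrier} :
    (M.pgAction hZ).Act ξ δ ζ ↔
      ξ ≠ [] ∧ M.ActDom ξ (steps δ) ∧ ζ = ξ.map (M.shift (steps δ).prod) := by
  constructor
  · rintro ⟨h1, h2, rfl⟩
    exact ⟨H.ne_nil_of_mem h1, h2, rfl⟩
  · rintro ⟨h1, ⟨z, hz, hx⟩, rfl⟩
    exact ⟨(M.mem_dom _).2 ⟨h1, z, hz.start, hx⟩, ⟨z, hz, hx⟩, rfl⟩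

/-- The total step of a word in the semidirect product. -/
def total (α : List (M.pgAction hZ).SemiCarrier) : ℤ :=
  (α.map fun a => a.fst.1.toAdd).sum

theorem total_cons (a : (M.pgAction hZ).SemiCarrier) (α : List (M.pgAction hZ).SemiCarrier) :
    total (a :: α) = a.fst.1.toAdd + total α := rfl

theorem total_eq (α : List (M.pgAction hZ).SemiCarrier) :
    total α = (steps (α.map PGAction.SemiCarrier.fst)).prod.toAdd := by
  induction α with
  | nil => rfl
  | cons a α ih => rw [total_cons, ih, List.map_cons, steps_cons, List.prod_cons, toAdd_mul]

theorem steps_bar_cons (a : (M.pgAction hZ).SemiCarrier) (α : List (M.pgAction hZ).SemiCarrier) :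
    steps (PGAction.bar (a :: α)) = steps (PGAction.bar α) ++ [a.fst.1⁻¹] := by
  rw [PGAction.bar_cons, steps_append]
  rfl

/-- The route of `bar α` runs through the steps of `α` backwards, with opposite signs. -/
theorem toAdd_prod_steps_bar (α : List (M.pgAction hZ).SemiCarrier) :
    (steps (PGAction.bar α)).prod.toAdd = - total α := by
  induction α with
  | nil => rfl
  | cons a α ih =>
    rw [steps_bar_cons, List.prod_append, toAdd_mul, ih, total_cons, List.prod_singleton, toAdd_inv]
    ring

/-- The element `γ ^ δ * η` for an element `δ ⋉ η` of the semidirect product. -/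
def realize (a : (M.pgAction hZ).SemiCarrier) : N := γ ^ a.fst.1.toAdd * M.val a.snd

/-- With `t` the total of the later letters, the letter `a` has second component `γ ^ t * x * (γ ^
t)⁻¹`. The factor `(γ ^ t)⁻¹` cancels the power in front of the product of the tail, and the powers
of `γ` collect on the left. -/
theorem prod_map_realize {α : List (M.pgAction hZ).SemiCarrier} {ξ : List H.carrier}
    (h : PGAction.Spine [] ξ α) {z : ℤ} (hz : IsRoute Z z (steps (PGAction.bar α)))
    (hx : ∀ x ∈ ξ, M.val x ∈ A z) :
    (α.map realize).prod = γ ^ total α * (ξ.map M.val).prod := by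
  induction α generalizing ξ with
  | nil =>
    obtain rfl : ξ = [] := by simpa using h.length
    simp [total]
  | cons a α ih => cases ξ with
    | nil => exact h.elim
    | cons x ξ =>
      rw [steps_bar_cons, isRoute_append] at hz
      obtain ⟨-, -, h3⟩ := act_iff.1 h.1
      have e : a.snd = M.shift (steps (PGAction.bar α)).prod x := by simpa using h3
      rw [List.map_cons, List.prod_cons, ih h.2 hz.1 fun y hy => hx y (by simp [hy]), realize, e,
        val_shift (hx x (by simp)) hz.1.add_mem, toAdd_prod_steps_bar, total_cons, List.map_cons,
        List.prod_cons, zpow_add, zpow_neg]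
      group

end

variable {X₀ : Type v} [MulAction Nᵐᵒᵖ X₀] {k : X₀} {L : Subgroup N}
  {M : ConjModel H (fun z => rightStabilizer L (k <• γ ^ z)) Z γ} {hZ : Z.Nonempty}

/-- The base point `z` of the spine is the end of the parade, so the parade starts at `z - total α`.
The isometric part of each letter fixes the component reached by its power of `γ`, so the parade
visits the same components as the integer route. -/
theorem isRoute_map_realize {α : List (M.pgAction hZ).SemiCarrier} {ξ : List H.carrier}
    (h : PGAction.Spine [] ξ α) {z : ℤ} (hz : IsRoute Z z (steps (PGAction.bar α)))
    (hx : ∀ x ∈ ξ, M.val x ∈ rightStabilizer L (k <• γ ^ z)) :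
    IsRoute ((fun z : ℤ => k <• γ ^ z) '' Z) (k <• γ ^ (z - total α)) (α.map realize) := by
  induction α generalizing ξ with
  | nil => exact ⟨z, hz.start, by simp [total]⟩
  | cons a α ih => cases ξ with
    | nil => exact h.elim
    | cons x ξ =>
      have hm := hz.add_mem
      rw [toAdd_prod_steps_bar] at hm
      rw [steps_bar_cons, isRoute_append] at hz
      obtain ⟨-, -, h3⟩ := act_iff.1 h.1
      have e : a.snd = M.shift (steps (PGAction.bar α)).prod x := by simpa using h3
      have hs := (val_shift_mem (M := M) (A := fun z => rightStabilizer L (k <• γ ^ z))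
        (hx x (by simp)) hz.1.add_mem).2
      rw [← e, toAdd_prod_steps_bar] at hs
      refine ⟨⟨_, hm, rfl⟩, ?_⟩
      have e2 : (k <• γ ^ (z - total (a :: α))) <• realize a = k <• γ ^ (z - total α) := by
        rw [realize, MulOpposite.op_mul, mul_smul, smul_zpow_zpow, total_cons]
        rw [show z - (a.fst.1.toAdd + total α) + a.fst.1.toAdd = z + -total α by ring, hs]
        rfl
      rw [e2]
      exact ih h.2 hz.1 fun y hy => hx y (by simp [hy])

/-- Converse of `isRoute_map_realize`: `hX` and `hL` recover the integer step of each letter from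
the components it joins. Its isometric part then stabilizes the component just reached, and
conjugation by `γ ^ total α` carries it on to the end of the parade, which gives the letter of the
spine. -/
theorem exists_spine (hL : ∀ n : ℤ, γ ^ n ∈ L → n = 0)
    (hX : ∀ z ∈ Z, ∀ z' ∈ Z, ∀ g : N, (k <• γ ^ z) <• g = k <• γ ^ z' → (γ ^ (z' - z))⁻¹ * g ∈ L)
    [L.Normal] {α : List (M.pgAction hZ).SemiCarrier} {z : ℤ} (hz : z ∈ Z)
    (h : IsRoute ((fun z : ℤ => k <• γ ^ z) '' Z) (k <• γ ^ z) (α.map realize)) :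
    ∃ ξ, ∃ z', PGAction.Spine [] ξ α ∧ IsRoute Z z' (steps (PGAction.bar α)) ∧
      (∀ x ∈ ξ, M.val x ∈ rightStabilizer L (k <• γ ^ z')) ∧ z' = z + total α := by
  induction α generalizing z with
  | nil => exact ⟨[], z, trivial, hz, by simp, (add_zero z).symm⟩
  | cons a α ih =>
    obtain ⟨z₁, hz₁, e₁⟩ := h.2.start
    have h2 := h.2
    change k <• γ ^ z₁ = (k <• γ ^ z) <• realize a at e₁
    -- Membership of `(η | δ⁻¹)` in the domain places `η` in some stabilizer, hence in `L`.
    have hval : M.val a.snd ∈ L := by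
      obtain ⟨y, -, hy⟩ := a.mem
      exact (hy a.snd (by simp [single])).1
    have hd : a.fst.1.toAdd = z₁ - z := by
      -- The factor from `L` cancels, and what remains is a power of `γ` in `L`, whose exponent
      -- vanishes by `hL`.
      have h3 := hX z hz z₁ hz₁ _ e₁.symm
      rw [realize, ← mul_assoc, Subgroup.mul_mem_cancel_right _ hval, ← zpow_neg, ← zpow_add] at h3
      have := hL _ h3
      omega
    have hs : M.val a.snd ∈ rightStabilizer L (k <• γ ^ z₁) := by
      refine ⟨hval, ?_⟩
      rw [realize, MulOpposite.op_mul, mul_smul, smul_zpow_zpow, hd, add_sub_cancel] at e₁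
      exact e₁.symm
    obtain ⟨ξ, z', h4, h5, h6, rfl⟩ := ih hz₁ (by rw [e₁]; exact h2)
    have h7 := conj_mem_rightStabilizer z₁ (total α) hs
    -- The new letter of the spine: the isometric part of `a` transported to the end of the parade.
    obtain ⟨x, hx⟩ := M.exists_val _ h5.start _ h7
    have h8 := h5.add_mem
    refine ⟨x :: ξ, z₁ + total α, ⟨?_, h4⟩, ?_, ?_, ?_⟩
    · refine act_iff.2 ⟨by simp, ⟨z₁ + total α, h5, ?_⟩, ?_⟩
      · simpa [hx] using h7
      · rw [List.nil_append, List.map_singleton]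
        congr 1
        apply M.val_injective
        rw [val_shift (z := z₁ + total α) (by rw [hx]; exact h7) h8, hx, toAdd_prod_steps_bar]
        group
    · rw [steps_bar_cons, isRoute_append]
      refine ⟨h5, h8, ?_⟩
      change z₁ + total α + (steps (PGAction.bar α)).prod.toAdd + (a.fst.1⁻¹).toAdd ∈ Z
      rw [toAdd_prod_steps_bar, toAdd_inv, hd]
      convert hz using 1
      ring
    · intro y hy
      rcases List.mem_cons.1 hy with rfl | hy
      · rw [hx]; exact h7
      · exact h6 y hy
    · rw [total_cons, hd]
      ring

/-- The semidirect product of the vector parades in `Z` and a union of stabilizers is the partial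
group of the parades in a part of an orbit of `γ`. -/
theorem nonempty_iso_parade (M : ConjModel H (fun z => rightStabilizer L (k <• γ ^ z)) Z γ)
    (hZ : Z.Nonempty) [L.Normal] (hL : ∀ n : ℤ, γ ^ n ∈ L → n = 0)
    (hX : ∀ z ∈ Z, ∀ z' ∈ Z, ∀ g : N, (k <• γ ^ z) <• g = k <• γ ^ z' → (γ ^ (z' - z))⁻¹ * g ∈ L)
    (hne : ((fun z : ℤ => k <• γ ^ z) '' Z).Nonempty) :
    Nonempty ((M.pgAction hZ).semidirect ≅ parade N ((fun z : ℤ => k <• γ ^ z) '' Z) hne) := by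
  have hroute : ∀ α : List (M.pgAction hZ).SemiCarrier, PGAction.SemiDom α →
      ∃ x, IsRoute ((fun z : ℤ => k <• γ ^ z) '' Z) x (α.map realize) := by
    intro α h
    obtain ⟨ξ, ζ, h1, h2⟩ := PGAction.semiDom_iff.1 h
    obtain ⟨-, ⟨z, hz, hx⟩, -⟩ := act_iff.1 h2
    exact ⟨_, isRoute_map_realize h1 hz hx⟩
  let f : (M.pgAction hZ).SemiCarrier → ParadeCarrier N ((fun z : ℤ => k <• γ ^ z) '' Z) :=
    fun a => ⟨realize a, hroute [a] (PGAction.semiDom_singleton a)⟩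
  have hf : ∀ α : List (M.pgAction hZ).SemiCarrier,
      (α.map f).map Subtype.val = α.map realize := fun α => List.map_map
  let F : (M.pgAction hZ).semidirect ⟶ parade N ((fun z : ℤ => k <• γ ^ z) '' Z) hne :=
    { toFun := f
      map_mem := fun α h => by
        obtain ⟨x, hx⟩ := hroute α h
        refine ⟨fun e => PGAction.SemiDom.ne_nil h (List.map_eq_nil_iff.1 e), x, ?_⟩
        exact (congrArg (IsRoute _ x) (hf α)).mpr hx
      map_prod := fun (α : List (M.pgAction hZ).SemiCarrier) h => by
        apply Subtype.ext
        obtain ⟨ξ, ζ, h1, h2⟩ := PGAction.semiDom_iff.1 h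
        obtain ⟨-, ⟨z, hz, hx⟩, -⟩ := act_iff.1 h2
        refine (congrArg List.prod (hf α)).trans ((prod_map_realize h1 hz hx).trans ?_)
        have e := h1.A_eq h.1
        have e1 : M.val (H.prod (PGAction.A α h.1) h.2.1) = (ξ.map M.val).prod := by
          rw [M.val_prod, e]
        rw [← e1, total_eq]
        rfl }
  refine nonempty_iso_of_bijective F ⟨?_, ?_⟩ ?_
  · intro (a : (M.pgAction hZ).SemiCarrier) (b : (M.pgAction hZ).SemiCarrier) e
    have e' : realize a = realize b := congrArg Subtype.val e
    have hval : ∀ a : (M.pgAction hZ).SemiCarrier, M.val a.snd ∈ L := fun a => by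
      obtain ⟨y, -, hy⟩ := a.mem
      exact (hy a.snd (by simp [single])).1
    have hd : a.fst.1.toAdd = b.fst.1.toAdd := by
      -- Equality of realizations writes this power of `γ` as a quotient of two elements of `L`.
      have h : γ ^ (a.fst.1.toAdd - b.fst.1.toAdd) ∈ L := by
        rw [realize, realize, ← eq_mul_inv_iff_mul_eq, mul_assoc, ← inv_mul_eq_iff_eq_mul,
          ← zpow_neg, ← zpow_add, neg_add_eq_sub] at e'
        rw [e']
        exact mul_mem (hval b) (inv_mem (hval a))
      have := hL _ h
      omega
    refine PGAction.SemiCarrier.ext (Subtype.ext hd) (M.val_injective ?_)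
    rw [realize, realize, hd] at e'
    exact mul_left_cancel e'
  · rintro ⟨g, x, ⟨z, hz, rfl⟩, z', hz', e⟩
    change k <• γ ^ z' = (k <• γ ^ z) <• g at e
    -- Surjectivity: splitting off `γ ^ (z' - z)` on the left leaves an element of `L` that fixes
    -- the target component.
    have hs : (γ ^ (z' - z))⁻¹ * g ∈ rightStabilizer L (k <• γ ^ z') := by
      refine ⟨hX z hz z' hz' g e.symm, ?_⟩
      rw [MulOpposite.op_mul, mul_smul, ← zpow_neg, smul_zpow_zpow]
      rw [show z' + -(z' - z) = z by ring]
      exact e.symm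
    obtain ⟨y, hy⟩ := M.exists_val z' hz' _ hs
    -- The step is based at the source `z`, but `y` is based at the target `z'`, from which the
    -- inverse step leads back to `z`.
    refine ⟨⟨⟨Multiplicative.ofAdd (z' - z), z, hz, ?_⟩, y, z', ⟨hz', ?_⟩, ?_⟩, Subtype.ext ?_⟩
    · change z + (z' - z) ∈ Z
      simpa using hz'
    · change z' + -(z' - z) ∈ Z
      simpa using hz
    · intro x hx
      rw [List.mem_singleton.1 hx, hy]
      exact hs
    · change γ ^ (z' - z) * M.val y = g
      rw [hy, mul_inv_cancel_left]
  · rintro α ⟨hα, x, hx⟩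
    have hα' : α ≠ [] := fun e => hα (List.map_eq_nil_iff.2 e)
    obtain ⟨z, hz, rfl⟩ := hx.start
    have hx' : IsRoute ((fun z : ℤ => k <• γ ^ z) '' Z) (k <• γ ^ z)
        (List.map realize (α : List (M.pgAction hZ).SemiCarrier)) :=
      (congrArg (IsRoute _ _) (hf α)).mp hx
    obtain ⟨ξ, z', h1, h2, h3, -⟩ := exists_spine hL hX hz hx'
    refine PGAction.semiDom_of h1 (act_iff.2 ⟨?_, ⟨z', h2, h3⟩, rfl⟩)
    rintro rfl
    exact hα' (List.length_eq_zero_iff.1 h1.length.symm)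

end ConjModel

end PartialGroup

namespace Figure

open PartialGroup

/-! ### Isometries as the similarities of ratio 1. -/

section Ratio

variable {d : ℕ}

/-- The ratio of a similarity transformation. -/
noncomputable def simRatio (d : ℕ) : SimGroup d →* NNReal where
  toFun g := Dilation.ratio (MulOpposite.unop g)
  map_one' := DilationEquiv.ratioHom.map_one
  map_mul' a b := (DilationEquiv.ratioHom.map_mul (MulOpposite.unop b) (MulOpposite.unop a)).trans
    (mul_comm _ _)

theorem ediam_smul (K : Set (E d)) (g : SimGroup d) :
    Metric.ediam (K <• g) = simRatio d g * Metric.ediam K :=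
  Dilation.ediam_image (MulOpposite.unop g) K

theorem eucToSim_injective : Function.Injective (eucToSim d) := fun a b h => by
  apply MulOpposite.unop_injective
  ext1 x
  exact congrArg (fun g : SimGroup d => MulOpposite.unop g x) h

theorem mem_range_eucToSim {g : SimGroup d} : g ∈ (eucToSim d).range ↔ simRatio d g = 1 := by
  constructor
  · rintro ⟨a, rfl⟩
    exact IsometryEquiv.toDilationEquiv_ratio (MulOpposite.unop a)
  · intro h
    refine ⟨MulOpposite.op ⟨(MulOpposite.unop g).toEquiv, fun x y => ?_⟩, rfl⟩
    refine (Dilation.edist_eq (MulOpposite.unop g) x y).trans ?_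
    change ((simRatio d g : NNReal) : ENNReal) * _ = _
    rw [h, ENNReal.coe_one, one_mul]

/-- The isometries are the kernel of the ratio homomorphism. -/
instance normal_range_eucToSim : (eucToSim d).range.Normal := by
  have : (eucToSim d).range = (simRatio d).ker := by
    ext g
    rw [mem_range_eucToSim, MonoidHom.mem_ker]
  rw [this]
  infer_instance

/-- Translates symmetry groups, defined by isometries, into stabilizers inside the similarity group,
where conjugation by `γ` makes sense. -/
theorem mem_rightStabilizer_range {K : Set (E d)} {g : SimGroup d} :
    g ∈ rightStabilizer (eucToSim d).range K ↔ ∃ a ∈ symGroup K, eucToSim d a = g := by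
  constructor
  · rintro ⟨⟨a, rfl⟩, h⟩
    exact ⟨a, h, rfl⟩
  · rintro ⟨a, h, rfl⟩
    exact ⟨⟨a, rfl⟩, h⟩

end Ratio

/-! ### Two similar components that are not congruent. -/

section TwoComponents

variable {d : ℕ} {K : Fin 2 → Set (E d)} {γ : SimGroup d}

theorem smul_zpow_eq (hγ : K 0 <• γ = K 1) (i : Fin 2) :
    K 0 <• γ ^ (((i : ℕ) : ℤ)) = K i := by
  match i with
  | 0 => simp
  | 1 => simpa using hγ

theorem mem_zero_one_iff {z : ℤ} : z ∈ ({0, 1} : Set ℤ) ↔ ∃ i : Fin 2, z = ((i : ℕ) : ℤ) := by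
  simp [Fin.exists_fin_two]

theorem image_smul_zpow (hγ : K 0 <• γ = K 1) :
    (fun z : ℤ => K 0 <• γ ^ z) '' {0, 1} = Set.range K := by
  ext x
  constructor
  · rintro ⟨z, hz, rfl⟩
    obtain ⟨i, rfl⟩ := mem_zero_one_iff.1 hz
    exact ⟨i, (smul_zpow_eq hγ i).symm⟩
  · rintro ⟨i, rfl⟩
    exact ⟨_, mem_zero_one_iff.2 ⟨i, rfl⟩, smul_zpow_eq hγ i⟩

/-- If the ratio of `γ` were 1, `γ` would be a congruence of the components; and a nonnegative real
other than 1 has no nonzero integer power equal to 1. -/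
theorem eq_zero_of_zpow_mem (hcongr : ¬ Congruent (K 0) (K 1)) (hγ : K 0 <• γ = K 1) (n : ℤ)
    (h : γ ^ n ∈ (eucToSim d).range) : n = 0 := by
  have h1 : simRatio d γ ≠ 1 := fun h => by
    obtain ⟨a, rfl⟩ := mem_range_eucToSim.2 h
    exact hcongr ⟨a, hγ⟩
  rw [mem_range_eucToSim, map_zpow] at h
  exact (zpow_eq_one_iff_right₀ zero_le h1).1 h

/-- Both `g` and `γ ^ (z' - z)` take the same component to the same image, so they multiply its
diameter equally. A positive finite diameter can be cancelled, so the ratios agree. -/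
theorem inv_zpow_mul_mem (hpos : ∀ i, 0 < Metric.ediam (K i)) (hfin : ∀ i, Metric.ediam (K i) < ⊤)
    (hγ : K 0 <• γ = K 1) :
    ∀ z ∈ ({0, 1} : Set ℤ), ∀ z' ∈ ({0, 1} : Set ℤ), ∀ g : SimGroup d,
      (K 0 <• γ ^ z) <• g = K 0 <• γ ^ z' → (γ ^ (z' - z))⁻¹ * g ∈ (eucToSim d).range := by
  intro z hz z' _ g hg
  obtain ⟨i, rfl⟩ := mem_zero_one_iff.1 hz
  have e : K 0 <• γ ^ z' = (K 0 <• γ ^ ((i : ℕ) : ℤ)) <• γ ^ (z' - ((i : ℕ) : ℤ)) := by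
    rw [smul_zpow_zpow, add_sub_cancel]
  have h := congrArg Metric.ediam (hg.trans e)
  rw [smul_zpow_eq hγ, ediam_smul, ediam_smul, ENNReal.mul_left_inj (hpos i).ne' (hfin i).ne,
    ENNReal.coe_inj] at h
  rw [mem_range_eucToSim, map_mul, h, ← map_mul, inv_mul_cancel, map_one]

variable {H : PartialGroup.{0}} {j : ∀ i, symPartialGroup (K i) ⟶ H}

/-- The pushout of the two symmetry groups, realized in the group of similarities. -/
theorem exists_conjModel (hγ : K 0 <• γ = K 1)
    (hp : IsPushout (interRight (K 0) (K 1)) (interLeft (K 0) (K 1)) (j 1) (j 0)) :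
    ∃ M : ConjModel H (fun z : ℤ => rightStabilizer (eucToSim d).range (K 0 <• γ ^ z)) {0, 1} γ,
      ∀ i (a : symGroup (K i)), M.val ((j i).toFun a) = eucToSim d a := by
  let C := unionOfSubgroups fun i => symGroup (K i)
  have hC : IsPushout (interRight (K 0) (K 1)) (interLeft (K 0) (K 1))
    (toUnion (fun i => symGroup (K i)) 1) (toUnion (fun i => symGroup (K i)) 0) :=
    isPushout_union fun i => symGroup (K i)
  -- The given pushout is arbitrary; uniqueness of pushouts identifies it with the concrete union,
  -- compatibly with the maps from both groups.
  let e : H ≅ C := hp.isoIsPushout _ _ hC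
  have he : ∀ i, j i ≫ e.hom = toUnion (fun i => symGroup (K i)) i := fun i =>
    match i with
    | 0 => hp.inr_isoIsPushout_hom _ _ hC
    | 1 => hp.inl_isoIsPushout_hom _ _ hC
  have hinv : ∀ x, e.inv.toFun (e.hom.toFun x) = x := fun x =>
    congrArg (fun f => Hom.toFun f x) e.hom_inv_id
  let val : H.carrier → SimGroup d := fun x => eucToSim d (e.hom.toFun x).1
  have hval : ∀ i (a : symGroup (K i)), val ((j i).toFun a) = eucToSim d a := fun i a =>
    by
    let x : (symPartialGroup (K i)).carrier := a
    exact congrArg (fun f : symPartialGroup (K i) ⟶ C => eucToSim d (Hom.toFun f x).1) (he i)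
  have hmem : ∀ (i : Fin 2) x, val x ∈ rightStabilizer (eucToSim d).range
      (K 0 <• γ ^ (((i : ℕ) : ℤ))) ↔ (e.hom.toFun x).1 ∈ symGroup (K i) := by
    intro i x
    rw [smul_zpow_eq hγ, mem_rightStabilizer_range]
    constructor
    · rintro ⟨a, ha, hx⟩
      rwa [← eucToSim_injective hx]
    · exact fun h => ⟨_, h, rfl⟩
  refine ⟨⟨val, ?_, ?_, ?_, ?_, fun z n g hg => conj_mem_rightStabilizer z n hg⟩, hval⟩
  · intro x y h
    rw [← hinv x, ← hinv y, Subtype.ext (eucToSim_injective h)]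
  · intro w
    constructor
    · intro h
      obtain ⟨-, i, hi⟩ := e.hom.map_mem w h
      exact ⟨H.ne_nil_of_mem h, _, mem_zero_one_iff.2 ⟨i, rfl⟩, fun x hx =>
        (hmem i x).2 (hi _ (List.mem_map_of_mem hx))⟩
    · rintro ⟨hw, z, hz, h⟩
      obtain ⟨i, rfl⟩ := mem_zero_one_iff.1 hz
      have h1 : w.map e.hom.toFun ∈ C.dom := by
        refine ⟨fun e => hw (List.map_eq_nil_iff.1 e), i, fun y hy => ?_⟩
        obtain ⟨x, hx, rfl⟩ := List.mem_map.1 hy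
        exact (hmem i x).1 (h x hx)
      -- Multipliability in the union returns to `H` along the inverse isomorphism.
      have h2 := e.inv.map_mem _ h1
      rwa [List.map_map, show e.inv.toFun ∘ e.hom.toFun = id from funext hinv, List.map_id] at h2
  · intro z hz g hg
    obtain ⟨i, rfl⟩ := mem_zero_one_iff.1 hz
    rw [smul_zpow_eq hγ] at hg
    obtain ⟨a, ha, rfl⟩ := mem_rightStabilizer_range.1 hg
    exact ⟨_, hval i ⟨a, ha⟩⟩
  · intro w h
    have h1 := congrArg (fun x => eucToSim d x.1) (e.hom.map_prod w h)
    refine h1.symm.trans ((map_list_prod (eucToSim d) _).trans (congrArg List.prod ?_))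
    refine List.map_map.trans ?_
    exact List.map_map

/-- The conjugation depends only on the total step of `δ`, and this is the difference of the end
points of the route, whichever admissible starting index is used. -/
theorem isConjAction_pgAction (hγ : K 0 <• γ = K 1)
    (M : ConjModel H (fun z : ℤ => rightStabilizer (eucToSim d).range (K 0 <• γ ^ z)) {0, 1} γ)
    (hZ : ({0, 1} : Set ℤ).Nonempty)
    (hM : ∀ i (a : symGroup (K i)), M.val ((j i).toFun a) = eucToSim d a) :
    IsConjAction j γ (M.pgAction hZ) := by
  have hA : ∀ (i : Fin 2) g, g ∈ rightStabilizer (eucToSim d).range (K 0 <• γ ^ (((i : ℕ) : ℤ))) ↔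
      ∃ a ∈ symGroup (K i), eucToSim d a = g := fun i g => by
    rw [smul_zpow_eq hγ, mem_rightStabilizer_range]
  have hj : ∀ (i : Fin 2) (a : symGroup (K i)), M.val ((j i).toFun a) ∈
      rightStabilizer (eucToSim d).range (K 0 <• γ ^ (((i : ℕ) : ℤ))) := fun i a =>
    (hA i _).2 ⟨a.1, a.2, (hM i a).symm⟩
  constructor
  · intro η δ
    constructor
    · rintro ⟨z, hz, hx⟩
      obtain ⟨i, rfl⟩ := mem_zero_one_iff.1 hz.start
      refine ⟨i, hz, ?_⟩
      -- The letters share one base point, so they all come from the symmetry group of the same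
      -- component.
      have h : ∀ x ∈ η.1, ∃ a : symGroup (K i), (j i).toFun a = x := fun x h => by
        obtain ⟨a, ha, e⟩ := (hA i _).1 (hx x h)
        exact ⟨⟨a, ha⟩, M.val_injective ((hM i _).trans e)⟩
      choose! f hf using h
      refine ⟨η.1.map f, ?_⟩
      exact (List.map_id _).symm.trans
        ((List.map_congr_left fun x hx => (hf x hx).symm).trans List.map_map.symm)
    · rintro ⟨i, hz, a, ha⟩
      refine ⟨_, hz, fun x hx => ?_⟩
      rw [ha] at hx
      obtain ⟨b, -, rfl⟩ := List.mem_map.1 hx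
      exact hj i b
  · intro η δ h i k hz hk a ha
    have hk' : ((i : ℕ) : ℤ) + (steps δ).prod.toAdd = ((k : ℕ) : ℤ) := hk
    have hn : (steps δ).prod.toAdd = ((k : ℕ) : ℤ) - ((i : ℕ) : ℤ) := by omega
    have hs : ∀ x : symGroup (K i), ∃ y : symGroup (K k),
        (j k).toFun y = M.shift (steps δ).prod ((j i).toFun x) ∧
        eucToSim d (y : EucGroup d) = γ ^ (((i : ℕ) : ℤ) - ((k : ℕ) : ℤ)) *
          eucToSim d (x : EucGroup d) * γ ^ (((k : ℕ) : ℤ) - ((i : ℕ) : ℤ)) := by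
      intro x
      have h1 := ConjModel.val_shift_mem (M := M) (hj i x) (n := (steps δ).prod)
        (IsRoute.add_mem hz)
      have h2 := ConjModel.val_shift (M := M) (hj i x) (n := (steps δ).prod) (IsRoute.add_mem hz)
      rw [hk'] at h1
      obtain ⟨y, hy, e⟩ := (hA k _).1 h1
      refine ⟨⟨y, hy⟩, M.val_injective ((hM k _).trans e), ?_⟩
      rw [e, h2, hn, hM, ← zpow_neg, neg_sub]
    choose f hf1 hf2 using hs
    refine ⟨a.map f, ?_, ?_⟩
    · refine (congrArg (List.map (M.shift (steps δ).prod)) ha).trans ?_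
      refine List.map_map.trans (Eq.trans ?_ List.map_map.symm)
      exact List.map_congr_left fun x _ => (hf1 x).symm
    · simp only [bind_pure_comp, List.map_eq_map, List.forall₂_map_left_iff,
        List.forall₂_map_right_iff, List.forall₂_same]
      exact fun x _ => hf2 x

end TwoComponents

end Figure

/-! ### Assembling the theorem. -/

theorem theorem12p2 {d : ℕ} (F : Set (Figure.E d)) (hF : F.Nonempty)
    (K : Fin 2 → Set (Figure.E d)) (hK : Figure.components F = Set.range K)
    (hcongr : ¬ Figure.Congruent (K 0) (K 1))
    (hpos : ∀ i, 0 < Metric.ediam (K i)) (hfin : ∀ i, Metric.ediam (K i) < ⊤)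
    (γ : Figure.SimGroup d) (hγ : K 0 <• γ = K 1) :
    Limits.HasPushout (Figure.interRight (K 0) (K 1)) (Figure.interLeft (K 0) (K 1)) ∧
    ∀ (H : PartialGroup.{0}) (j : ∀ i, Figure.symPartialGroup (K i) ⟶ H),
      IsPushout (Figure.interRight (K 0) (K 1)) (Figure.interLeft (K 0) (K 1)) (j 1) (j 0) →
      ∃ S : PartialGroup.PGAction PartialGroup.V01 H, Figure.IsConjAction j γ S ∧
        Nonempty (Figure.simPartialGroup F hF ≅ S.semidirect) := by
  refine ⟨(PartialGroup.isPushout_union fun i => Figure.symGroup (K i)).hasPushout,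
    fun H j hp => ?_⟩
  obtain ⟨M, hM⟩ := Figure.exists_conjModel hγ hp
  refine ⟨M.pgAction ⟨0, by simp⟩, Figure.isConjAction_pgAction hγ M _ hM, ?_⟩
  -- Stated for a variable set `X` so that the equality with the set of components can be
  -- substituted in the type of the parade partial group.
  have key : ∀ (X : Set (Set (Figure.E d))) (hX : X.Nonempty),
      (fun z : ℤ => K 0 <• γ ^ z) '' {0, 1} = X →
      Nonempty ((M.pgAction ⟨0, by simp⟩).semidirect ≅
        PartialGroup.parade (Figure.SimGroup d) X hX) := by
    rintro _ hX rfl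
    exact M.nonempty_iso_parade _ (Figure.eq_zero_of_zpow_mem hcongr hγ)
      (Figure.inv_zpow_mul_mem hpos hfin hγ) hX
  obtain ⟨e⟩ := key _ (Figure.components_nonempty hF)
    ((Figure.image_smul_zpow hγ).trans hK.symm)
  exact ⟨e.symm⟩
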